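/- Let $m$ be a $\sigma$-finite measure on a measurable space $\mathbf E$, let $L^2(m)$ be the real Hilbert space $L^2(\mathbf E,m)$ with inner product $(\cdot,\cdot)$ and norm $\|\cdot\|$, and let $(P_t)_{t\ge 0}$ be a strongly continuous semigroup of bounded operators on $L^2(m)$ which is symmetric, $(P_tf,g)=(f,P_tg)$, and sub-Markovian: $0\le f\le 1$ $m$-a.e. implies $0\le P_tf\le 1$ $m$-a.e. (for instance, the semigroup of an $m$-symmetric Markov process). Let $A$ be its generator, $Af=\lim_{t\downarrow 0}(P_tf-f)/t$, with domain the set of $f$ for which this limit exists in $L^2(m)$. Then there is a spectral family $(E_\lambda)_{0\le\lambda<\infty}$, that is, a family of orthogonal projections on $L^2(m)$ with $E_\lambda E_\mu=E_\lambda$ for $\lambda\le\mu$, $\lambda\mapsto E_\lambda f$ right continuous and $\lim_{\lambda\to\infty}E_\lambda f=f$ for all $f$, such that $-A=\int_{[0,\infty)}\lambda\,dE_\lambda$. For continuous $\psi:[0,\infty)\to\mathbb R$ write $\psi(-A)=\int_{[0,\infty)}\psi(\lambda)\,dE_\lambda$, the operator with domain $\{f\in L^2(m):\int_{[0,\infty)}\psi(\lambda)^2\,d(E_\lambda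 f,f)<\infty\}$; the integrals include the mass $E_0$ at $\lambda=0$. **Theorem 3.1.** Let $t>0$ and let $\phi:[0,\infty)\to[0,\infty)$ be a continuous function with $\liminf_{x\to\infty}\phi(x)>0$ (the value $+\infty$ being allowed) and $\sup_{x\ge 0}e^{-tx}\phi(x)<\infty$. Then for every $g\in L^2(m)$ and every $\gamma\in(0,1)$ there is exactly one $f\in L^2(m)$ that belongs to the domain of $\phi(-A)$ and satisfies $$(1-\gamma)P_tf+\gamma\,\phi(-A)f=g .$$ It is given by $$f=\int_{[0,\infty)}\frac{1}{\gamma\phi(\lambda)+(1-\gamma)e^{-\lambda t}}\,dE_\lambda g .$$ Moreover, $(1-\gamma)f$ is the unique minimiser over all $h\in L^2(m)$ of $$\|P_th-g\|^2+\frac{\gamma}{1-\gamma}\,\bigl(P_t\phi(-A)h,h\bigr),$$ where $P_t\phi(-A)$ denotes the bounded operator $\int_{[0,\infty)}e^{-t\lambda}\phi(\lambda)\,dE_\lambda$ on $L^2(m)$, which agrees with the composition of $P_t$ and $\phi(-A)$ on the domain of $\phi(-A)$. -/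

import Mathlib

noncomputable section

namespace MarkovInverse

section Spectral

variable {H : Type*} [NormedAddCommGroup H] [InnerProductSpace ℝ H] [CompleteSpace H]

/-- A spectral family `(E_s)` of orthogonal projections on `H`, indexed by `[0, ∞)` and extended by
`0` to negative indices (so that the mass of `dE` at the point `0` is `E_0`). -/
structure SpectralFamily (H : Type*) [NormedAddCommGroup H] [InnerProductSpace ℝ H]
    [CompleteSpace H] where
  proj : ℝ → H →L[ℝ] H
  isStarProjection : ∀ s, IsStarProjection (proj s)
  proj_of_neg : ∀ s, s < 0 → proj s = 0
  proj_comp : ∀ r s, r ≤ s → proj r ∘L proj s = proj r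
  right_continuous : ∀ (f : H) (s : ℝ),
    ContinuousWithinAt (fun r => proj r f) (Set.Ici s) s
  tendsto_atTop : ∀ f : H, Filter.Tendsto (fun s => proj s f) Filter.atTop (nhds f)

namespace SpectralFamily

variable (E : SpectralFamily H)

theorem inner_proj_self (f : H) (s : ℝ) : inner ℝ (E.proj s f) f = ‖E.proj s f‖ ^ 2 := by
  have hP := E.isStarProjection s
  have h1 : E.proj s (E.proj s f) = E.proj s f :=
    DFunLike.congr_fun hP.isIdempotentElem f
  have h2 := (ContinuousLinearMap.isSelfAdjoint_iff_isSymmetric.mp hP.isSelfAdjoint)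
    (E.proj s f) f
  simp only [ContinuousLinearMap.coe_coe] at h2
  rw [h1] at h2
  rw [h2, real_inner_self_eq_norm_sq]

theorem norm_proj_le (f : H) (s : ℝ) : ‖E.proj s f‖ ≤ ‖f‖ := by
  have h1 := E.inner_proj_self f s
  have h2 := real_inner_le_norm (E.proj s f) f
  by_contra hlt
  have h3 : 0 < ‖E.proj s f‖ := lt_of_le_of_lt (norm_nonneg f) (not_le.mp hlt)
  nlinarith [not_le.mp hlt]

/-- The right-continuous nondecreasing function `s ↦ (E_s f, f)`. -/
def stieltjes (f : H) : StieltjesFunction ℝ where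
  toFun s := inner ℝ (E.proj s f) f
  mono' := by
    intro r s hrs
    simp only [inner_proj_self]
    have h : E.proj r (E.proj s f) = E.proj r f := DFunLike.congr_fun (E.proj_comp r s hrs) f
    have h2 := E.norm_proj_le (E.proj s f) r
    rw [h] at h2
    gcongr
  right_continuous' s :=
    ContinuousWithinAt.inner (𝕜 := ℝ) (E.right_continuous f s) continuousWithinAt_const

/-- The measure `d(E_s f, f)`, which is carried by `[0, ∞)`. -/
def measure (f : H) : MeasureTheory.Measure ℝ := (E.stieltjes f).measure

/-- The domain of `∫_{[0,∞)} ψ dE`: those `f` with `∫ ψ(s)² d(E_s f, f) < ∞`. -/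
def domain (ψ : ℝ → ℝ) : Set H :=
  {f | MeasureTheory.IntegrableOn (fun s => ψ s ^ 2) (Set.Ici 0) (E.measure f)}

/-- The integral `∫_{[0,∞)} ψ(s) d(E_s f, h)`, where `d(E_s f, h)` is the signed measure obtained
from the measures `d(E_s k, k)` by polarisation. -/
def integral (ψ : ℝ → ℝ) (f h : H) : ℝ :=
  ((∫ s in Set.Ici (0 : ℝ), ψ s ∂(E.measure (f + h))) -
    ∫ s in Set.Ici (0 : ℝ), ψ s ∂(E.measure (f - h))) / 4

/-- The graph of the operator `∫_{[0,∞)} ψ dE`: `f` is in its domain and its value at `f` is `u`,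
that is `(u, h) = ∫ ψ(s) d(E_s f, h)`. It is enough to test against `h` in the domain, since for
continuous `ψ` this is a dense subspace; then `f + h` and `f - h` are in the domain as well, so
that both integrals converge. -/
def IsIntegral (ψ : ℝ → ℝ) (f u : H) : Prop :=
  f ∈ E.domain ψ ∧ ∀ h ∈ E.domain ψ, inner ℝ u h = E.integral ψ f h

end SpectralFamily

/-- `a = A f`, where `A` is the (infinitesimal) generator of `(P_t)`: `f` is in the domain of `A`
and `(P_t f - f) / t → a` in norm as `t ↓ 0`. -/
def IsGeneratorValue (P : NNReal → H →L[ℝ] H) (f a : H) : Prop :=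
  Filter.Tendsto (fun t : NNReal => (t : ℝ)⁻¹ • (P t f - f)) (nhdsWithin 0 (Set.Ioi 0)) (nhds a)

/-- `-A = ∫_{[0,∞)} s dE_s` as unbounded operators (with equality of domains), `A` being the
generator of `(P_t)`. -/
def IsSpectralFamilyOfNegGenerator (P : NNReal → H →L[ℝ] H) (E : SpectralFamily H) : Prop :=
  ∀ f a : H, IsGeneratorValue P f a ↔ E.IsIntegral (fun s => s) f (-a)

/-- `f` solves `(1 - γ) P_t f + γ φ(-A) f = g`; in particular `f` is in the domain of `φ(-A)`. -/
def IsRegularisedSolution (P : NNReal → H →L[ℝ] H) (E : SpectralFamily H) (φ : ℝ → ℝ)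
    (t : NNReal) (γ : ℝ) (g f : H) : Prop :=
  ∃ u : H, E.IsIntegral φ f u ∧ (1 - γ) • P t f + γ • u = g

/-- The bounded operator `B` is `P_t φ(-A)`: it is the everywhere defined operator
`∫ exp(-t s) φ(s) dE_s`, and it agrees with the composition of `P_t` and `φ(-A)` on the domain of
`φ(-A)`. -/
def IsSemigroupComp (P : NNReal → H →L[ℝ] H) (E : SpectralFamily H) (φ : ℝ → ℝ)
    (t : NNReal) (B : H →L[ℝ] H) : Prop :=
  (∀ h, E.IsIntegral (fun s => Real.exp (-(t * s)) * φ s) h (B h)) ∧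
    ∀ h u, E.IsIntegral φ h u → B h = P t u

/-- The functional `‖P_t h - g‖² + γ / (1 - γ) (P_t φ(-A) h, h)`, with `B` for `P_t φ(-A)`. -/
def functional (P : NNReal → H →L[ℝ] H) (B : H →L[ℝ] H) (t : NNReal) (γ : ℝ) (g h : H) : ℝ :=
  ‖P t h - g‖ ^ 2 + γ / (1 - γ) * inner ℝ (B h) h

end Spectral

/-- A strongly continuous, `m`-symmetric, sub-Markovian semigroup on the real space `L²(m)`. -/
structure IsSymmetricSubMarkovSemigroup {X : Type*} [MeasurableSpace X]
    (m : MeasureTheory.Measure X)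
    (P : NNReal → MeasureTheory.Lp ℝ 2 m →L[ℝ] MeasureTheory.Lp ℝ 2 m) : Prop where
  zero : P 0 = ContinuousLinearMap.id ℝ _
  add : ∀ s t, P (s + t) = P s ∘L P t
  strongly_continuous : ∀ f,
    Filter.Tendsto (fun t => P t f) (nhdsWithin 0 (Set.Ioi 0)) (nhds f)
  symmetric : ∀ t f g, inner ℝ (P t f) g = inner ℝ f (P t g)
  subMarkovian : ∀ t (f : MeasureTheory.Lp ℝ 2 m), (∀ᵐ x ∂m, 0 ≤ f x ∧ f x ≤ 1) →
    ∀ᵐ x ∂m, 0 ≤ P t f x ∧ P t f x ≤ 1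

end MarkovInverse

end

noncomputable section

namespace MarkovInverse

/-! Once `P t` is known to be `∫ exp (-ts) dE_s`, every claim becomes a statement about functions on
`[0, ∞)`. The symbol `q = γ φ + (1 - γ) exp (-ts)` is bounded below by a positive constant: for
large `s` the term `γ φ` does this, on the remaining compact interval the exponential does. Hence `1
/ q` and `φ / q` are bounded, and `f = (1 / q) g` solves the equation. The functional is quadratic,
the equation for `f` says that `(1 - γ) f` is a critical point, and injectivity of `P t` makes the
minimum strict (`functional_lt_of_critical`).

The unbounded operators are handled by truncation: `u = ∫ ψ dE f` exactly when, for every `n`, `E_n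
u` is the bounded operator with symbol `ψ 1_{s ≤ n}` applied to `f` (`isIntegral_iff`). This also
identifies the generator of `∫ exp (-ts) dE_s`; a contraction semigroup is determined by its
generator (`eq_of_generator`), so `P` is that semigroup for every admissible `E` (`eq_semigroup`).

The existence of `E` is a spectral theorem, proved through a moment problem. Symmetry and the
sub-Markov property make `P` contractive. Diagonalising `P (1 / 2 ^ n)` on finite-dimensional Krylov
spaces and passing to a weak limit yields measures on `[0, 1]` with `(P t f, f) = ∫ x ^ t dν_f`
(`exists_representation`). By Weierstrass these moments determine `ν_f`, so polarisation gives a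
multiplicative Borel calculus (`exists_isBorelCalculus`), and the indicators of `x ≥ exp (-s)` give
the projections `E_s`. -/

open MeasureTheory Filter Topology Set

/-! ### Bounded functions and determining families. -/

/-- Bounded measurable real functions. -/
structure IsBddMeas {Ω : Type*} [MeasurableSpace Ω] (ψ : Ω → ℝ) : Prop where
  measurable : Measurable ψ
  bdd : ∃ C, ∀ x, |ψ x| ≤ C

namespace IsBddMeas

variable {Ω : Type*} [MeasurableSpace Ω] {ψ χ : Ω → ℝ}

theorem const (c : ℝ) : IsBddMeas (fun _ : Ω => c) :=
  ⟨measurable_const, |c|, fun _ => le_rfl⟩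

theorem exists_pos_bound (h : IsBddMeas ψ) : ∃ C, 0 < C ∧ ∀ x, |ψ x| ≤ C := by
  obtain ⟨C, hC⟩ := h.bdd
  exact ⟨max C 1, by positivity, fun x => (hC x).trans (le_max_left _ _)⟩

theorem add (hψ : IsBddMeas ψ) (hχ : IsBddMeas χ) : IsBddMeas (fun x => ψ x + χ x) := by
  obtain ⟨C, hC⟩ := hψ.bdd
  obtain ⟨D, hD⟩ := hχ.bdd
  exact ⟨hψ.measurable.add hχ.measurable, C + D,
    fun x => (abs_add_le _ _).trans (add_le_add (hC x) (hD x))⟩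

theorem mul (hψ : IsBddMeas ψ) (hχ : IsBddMeas χ) : IsBddMeas (fun x => ψ x * χ x) := by
  obtain ⟨C, h0, hC⟩ := hψ.exists_pos_bound
  obtain ⟨D, hD⟩ := hχ.bdd
  refine ⟨hψ.measurable.mul hχ.measurable, C * D, fun x => ?_⟩
  rw [abs_mul]
  exact mul_le_mul (hC x) (hD x) (abs_nonneg _) h0.le

theorem const_mul (c : ℝ) (hψ : IsBddMeas ψ) : IsBddMeas (fun x => c * ψ x) :=
  (const c).mul hψ

theorem neg (hψ : IsBddMeas ψ) : IsBddMeas (fun x => -ψ x) := by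
  simpa using hψ.const_mul (-1)

theorem sub (hψ : IsBddMeas ψ) (hχ : IsBddMeas χ) : IsBddMeas (fun x => ψ x - χ x) := by
  simpa [sub_eq_add_neg] using hψ.add hχ.neg

theorem sq (hψ : IsBddMeas ψ) : IsBddMeas (fun x => ψ x ^ 2) := by
  simpa [pow_two] using hψ.mul hψ

theorem indicator (hψ : IsBddMeas ψ) {s : Set Ω} (hs : MeasurableSet s) :
    IsBddMeas (s.indicator ψ) := by
  obtain ⟨C, h0, hC⟩ := hψ.exists_pos_bound
  refine ⟨hψ.measurable.indicator hs, C, fun x => ?_⟩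
  by_cases hx : x ∈ s
  · simpa [hx] using hC x
  · simpa [hx] using h0.le

theorem integrable (hψ : IsBddMeas ψ) (μ : Measure Ω) [IsFiniteMeasure μ] : Integrable ψ μ := by
  obtain ⟨C, hC⟩ := hψ.bdd
  exact Integrable.of_bound hψ.measurable.aestronglyMeasurable C (ae_of_all _ hC)

end IsBddMeas

/-- A family of functions whose integrals determine finite measures. -/
def Determines {Ω ι : Type*} [MeasurableSpace Ω] (d : ι → Ω → ℝ) : Prop :=
  ∀ (ν₁ ν₂ : Measure Ω) [IsFiniteMeasure ν₁] [IsFiniteMeasure ν₂],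
    (∀ i, ∫ x, d i x ∂ν₁ = ∫ x, d i x ∂ν₂) → ν₁ = ν₂

theorem isFiniteMeasure_withDensity_of_isBddMeas {Ω : Type*} [MeasurableSpace Ω] {w : Ω → ℝ}
    (hw : IsBddMeas w) (ν : Measure Ω) [IsFiniteMeasure ν] :
    IsFiniteMeasure (ν.withDensity fun x => ENNReal.ofReal (w x)) :=
  isFiniteMeasure_withDensity_ofReal (hw.integrable ν).2

theorem integral_withDensity_sub {Ω : Type*} [MeasurableSpace Ω] {w χ : Ω → ℝ}
    (hw : IsBddMeas w) (hχ : IsBddMeas χ) (ν : Measure Ω) [IsFiniteMeasure ν] :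
    (∫ x, χ x ∂(ν.withDensity fun x => ENNReal.ofReal (w x))) -
      ∫ x, χ x ∂(ν.withDensity fun x => ENNReal.ofReal (-w x)) = ∫ x, χ x * w x ∂ν := by
  have key : ∀ v : Ω → ℝ, IsBddMeas v →
      ∫ x, χ x ∂(ν.withDensity fun x => ENNReal.ofReal (v x)) = ∫ x, max (v x) 0 * χ x ∂ν ∧
      Integrable (fun x => max (v x) 0 * χ x) ν := by
    intro v hv
    constructor
    · rw [integral_withDensity_eq_integral_toReal_smul hv.measurable.ennreal_ofReal
        (ae_of_all _ fun _ => ENNReal.ofReal_lt_top)]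
      simp [ENNReal.toReal_ofReal', smul_eq_mul]
    · obtain ⟨C, h0, hC⟩ := hv.exists_pos_bound
      refine (IsBddMeas.mul ⟨hv.measurable.max measurable_const, C, fun x => ?_⟩ hχ).integrable ν
      rw [abs_of_nonneg (le_max_right _ _)]
      exact max_le ((le_abs_self _).trans (hC x)) h0.le
  rw [(key w hw).1, (key _ hw.neg).1, ← integral_sub (key w hw).2 (key _ hw.neg).2]
  congr 1
  ext x
  rcases le_total (w x) 0 with h | h
  · rw [max_eq_right h, max_eq_left (by linarith)]; ring
  · rw [max_eq_left h, max_eq_right (by linarith)]; ring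

/-- The signed measure `∑ w_k ν_k` is a difference of two finite measures, obtained from the
positive and negative parts of the densities. If it annihilates a determining family, the two
measures coincide. This transfers linear identities from the `d i` to all bounded measurable
functions. -/
theorem Determines.sum_integral_eq_zero {Ω ι κ : Type*} [MeasurableSpace Ω] [Fintype κ]
    {d : ι → Ω → ℝ} (hd : Determines d) (hdm : ∀ i, IsBddMeas (d i))
    (ν : κ → Measure Ω) (hν : ∀ k, IsFiniteMeasure (ν k)) (w : κ → Ω → ℝ)
    (hw : ∀ k, IsBddMeas (w k)) (h : ∀ i, ∑ k, ∫ x, d i x * w k x ∂(ν k) = 0)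
    {ψ : Ω → ℝ} (hψ : IsBddMeas ψ) : ∑ k, ∫ x, ψ x * w k x ∂(ν k) = 0 := by
  have hfp := fun k => isFiniteMeasure_withDensity_of_isBddMeas (hw k) (ν k)
  have hfn := fun k => isFiniteMeasure_withDensity_of_isBddMeas (hw k).neg (ν k)
  have key : ∀ χ : Ω → ℝ, IsBddMeas χ →
      (∫ x, χ x ∂(∑ k, (ν k).withDensity fun x => ENNReal.ofReal (w k x))) -
      ∫ x, χ x ∂(∑ k, (ν k).withDensity fun x => ENNReal.ofReal (-w k x)) =
      ∑ k, ∫ x, χ x * w k x ∂(ν k) := by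
    intro χ hχ
    rw [integral_finsetSum_measure fun k _ => hχ.integrable _,
      integral_finsetSum_measure fun k _ => hχ.integrable _, ← Finset.sum_sub_distrib]
    exact Finset.sum_congr rfl fun k _ => integral_withDensity_sub (hw k) hχ (ν k)
  rw [← key ψ hψ, hd _ _ fun i => sub_eq_zero.mp ((key _ (hdm i)).trans (h i)), sub_self]

/-! ### Polarisation and the Borel functional calculus. -/

section Calculus

variable {H : Type*} [NormedAddCommGroup H] [InnerProductSpace ℝ H]

theorem inner_eq_polar {T : H →L[ℝ] H} (hT : ∀ f h, inner ℝ (T f) h = inner ℝ f (T h)) (f h : H) :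
    inner ℝ (T f) h = (inner ℝ (T (f + h)) (f + h) - inner ℝ (T (f - h)) (f - h)) / 4 := by
  simp only [map_add, map_sub, inner_add_left, inner_add_right, inner_sub_left, inner_sub_right]
  rw [hT h f, real_inner_comm (T f) h]
  ring

theorem ext_of_quadratic {S T : H →L[ℝ] H} (hS : ∀ f h, inner ℝ (S f) h = inner ℝ f (S h))
    (hT : ∀ f h, inner ℝ (T f) h = inner ℝ f (T h))
    (h : ∀ f, inner ℝ (S f) f = inner ℝ (T f) f) : S = T := by
  ext f
  refine ext_inner_right ℝ fun v => ?_
  rw [inner_eq_polar hS, inner_eq_polar hT, h, h]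

/-- Finite measures `μ f` that represent the quadratic forms of a multiplicatively closed family of
symmetric operators `T i` as integrals of functions `d i` that determine finite measures. -/
structure SpectralData {Ω ι : Type*} [MeasurableSpace Ω] (μ : H → Measure Ω) (d : ι → Ω → ℝ)
    (T : ι → H →L[ℝ] H) : Prop where
  finite : ∀ f, IsFiniteMeasure (μ f)
  mass : ∀ f, (μ f).real Set.univ ≤ ‖f‖ ^ 2
  bddMeas : ∀ i, IsBddMeas (d i)
  determines : Determines d
  symm : ∀ i f h, inner ℝ (T i f) h = inner ℝ f (T i h)
  quad : ∀ i f, ∫ x, d i x ∂(μ f) = inner ℝ (T i f) f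
  mul : ∀ i j, ∃ k, (d k = fun x => d i x * d j x) ∧ T k = T i ∘L T j

/-- `Φ` is a functional calculus for bounded measurable functions, represented by the measures
`μ f`. -/
structure IsBorelCalculus {Ω : Type*} [MeasurableSpace Ω] (μ : H → Measure Ω)
    (Φ : (Ω → ℝ) → H →L[ℝ] H) : Prop where
  finite : ∀ f, IsFiniteMeasure (μ f)
  symm : ∀ ψ, IsBddMeas ψ → ∀ f h, inner ℝ (Φ ψ f) h = inner ℝ f (Φ ψ h)
  quad : ∀ ψ, IsBddMeas ψ → ∀ f, inner ℝ (Φ ψ f) f = ∫ x, ψ x ∂(μ f)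
  mul : ∀ ψ χ, IsBddMeas ψ → IsBddMeas χ → Φ (fun x => ψ x * χ x) = Φ ψ ∘L Φ χ

namespace SpectralData

variable {Ω ι : Type*} [MeasurableSpace Ω] {μ : H → Measure Ω} {d : ι → Ω → ℝ}
  {T : ι → H →L[ℝ] H}

/-- The polarisation of the quadratic form `f ↦ ∫ ψ dμ_f`. -/
def polar (μ : H → Measure Ω) (ψ : Ω → ℝ) (f h : H) : ℝ :=
  ((∫ x, ψ x ∂(μ (f + h))) - ∫ x, ψ x ∂(μ (f - h))) / 4

/-- Linear relations between values of quadratic forms, once valid for every `T i`, pass to `f ↦ ∫ ψ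
dμ_f`. Bilinearity and symmetry of `polar` thus reduce to expanding inner products. -/
theorem sum_eq_zero (D : SpectralData μ d T) {n : ℕ} (c : Fin n → ℝ) (f : Fin n → H)
    (h : ∀ i, ∑ k, c k * inner ℝ (T i (f k)) (f k) = 0) {ψ : Ω → ℝ} (hψ : IsBddMeas ψ) :
    ∑ k, c k * ∫ x, ψ x ∂(μ (f k)) = 0 := by
  have := D.determines.sum_integral_eq_zero D.bddMeas (fun k => μ (f k)) (fun k => D.finite _)
    (fun k _ => c k) (fun k => IsBddMeas.const _) (fun i => ?_) hψ
  · simpa only [integral_mul_const, mul_comm (c _)] using this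
  · simpa only [integral_mul_const, mul_comm (c _), D.quad] using h i

theorem polar_add_left (D : SpectralData μ d T) {ψ : Ω → ℝ} (hψ : IsBddMeas ψ) (f₁ f₂ h : H) :
    polar μ ψ (f₁ + f₂) h = polar μ ψ f₁ h + polar μ ψ f₂ h := by
  have := D.sum_eq_zero ![1, -1, -1, 1, -1, 1]
    ![f₁ + f₂ + h, f₁ + f₂ - h, f₁ + h, f₁ - h, f₂ + h, f₂ - h] (fun i => ?_) hψ
  · simp [Fin.sum_univ_succ] at this
    unfold polar
    linarith
  · simp [Fin.sum_univ_succ, inner_add_left, inner_add_right, inner_sub_left, inner_sub_right]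
    ring

theorem polar_smul_left (D : SpectralData μ d T) {ψ : Ω → ℝ} (hψ : IsBddMeas ψ) (c : ℝ) (f h : H) :
    polar μ ψ (c • f) h = c * polar μ ψ f h := by
  have := D.sum_eq_zero ![1, -1, -c, c]
    ![c • f + h, c • f - h, f + h, f - h] (fun i => ?_) hψ
  · simp [Fin.sum_univ_succ] at this
    unfold polar
    linarith
  · simp [Fin.sum_univ_succ, inner_add_left, inner_add_right, inner_sub_left, inner_sub_right,
      inner_smul_left, inner_smul_right]
    ring

theorem polar_comm (D : SpectralData μ d T) {ψ : Ω → ℝ} (hψ : IsBddMeas ψ) (f h : H) :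
    polar μ ψ f h = polar μ ψ h f := by
  have := D.sum_eq_zero ![1, -1, -1, 1]
    ![f + h, f - h, h + f, h - f] (fun i => ?_) hψ
  · simp [Fin.sum_univ_succ] at this
    unfold polar
    linarith
  · simp [Fin.sum_univ_succ, inner_add_left, inner_add_right, inner_sub_left, inner_sub_right]
    ring

theorem polar_self (D : SpectralData μ d T) {ψ : Ω → ℝ} (hψ : IsBddMeas ψ) (f : H) :
    polar μ ψ f f = ∫ x, ψ x ∂(μ f) := by
  have := D.sum_eq_zero ![1, -1, -4] ![f + f, f - f, f] (fun i => ?_) hψ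
  · simp only [Fin.sum_univ_succ] at this
    simp at this
    unfold polar
    simp only [sub_self]
    linarith
  · simp [Fin.sum_univ_succ, inner_add_left, inner_add_right]
    ring

theorem abs_integral_le (D : SpectralData μ d T) {ψ : Ω → ℝ} {C : ℝ}
    (h0 : 0 ≤ C) (hC : ∀ x, |ψ x| ≤ C) (f : H) : |∫ x, ψ x ∂(μ f)| ≤ C * ‖f‖ ^ 2 := by
  have := D.finite f
  have h1 : ‖∫ x, ψ x ∂(μ f)‖ ≤ C * (μ f).real Set.univ :=
    norm_integral_le_of_norm_le_const (ae_of_all _ hC)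
  exact h1.trans (mul_le_mul_of_nonneg_left (D.mass f) h0)

/-- The parallelogram law gives the bound `C (‖f‖² + ‖h‖²) / 2`; applying it to the normalised
vectors and using homogeneity turns the sum into a product. -/
theorem abs_polar_le (D : SpectralData μ d T) {ψ : Ω → ℝ} (hψ : IsBddMeas ψ) {C : ℝ}
    (h0 : 0 ≤ C) (hC : ∀ x, |ψ x| ≤ C) (f h : H) : |polar μ ψ f h| ≤ C * ‖f‖ * ‖h‖ := by
  have key : ∀ f h : H, |polar μ ψ f h| ≤ C * (‖f‖ ^ 2 + ‖h‖ ^ 2) / 2 := by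
    intro f h
    have h1 := abs_le.mp (D.abs_integral_le h0 hC (f + h))
    have h2 := abs_le.mp (D.abs_integral_le h0 hC (f - h))
    have h3 := parallelogram_law_with_norm ℝ f h
    have h4 : C * ‖f + h‖ ^ 2 + C * ‖f - h‖ ^ 2 = C * (2 * (‖f‖ ^ 2 + ‖h‖ ^ 2)) := by
      rw [← mul_add]; congr 1
    unfold polar
    rw [abs_le]
    constructor <;> linarith [h1.1, h1.2, h2.1, h2.2]
  rcases eq_or_ne f 0 with rfl | hf
  · have := D.polar_smul_left hψ 0 0 h
    simp only [zero_smul, zero_mul] at this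
    simp [this]
  rcases eq_or_ne h 0 with rfl | hh
  · have := D.polar_smul_left hψ 0 0 f
    simp only [zero_smul, zero_mul] at this
    rw [D.polar_comm hψ]
    simp [this]
  have hf' : 0 < ‖f‖ := norm_pos_iff.mpr hf
  have hh' : 0 < ‖h‖ := norm_pos_iff.mpr hh
  have e1 : polar μ ψ (‖f‖⁻¹ • f) (‖h‖⁻¹ • h) = ‖f‖⁻¹ * (‖h‖⁻¹ * polar μ ψ f h) := by
    rw [D.polar_smul_left hψ, D.polar_comm hψ, D.polar_smul_left hψ, D.polar_comm hψ]
  have e2 := key (‖f‖⁻¹ • f) (‖h‖⁻¹ • h)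
  rw [e1, norm_smul, norm_smul, norm_inv, norm_inv, norm_norm, norm_norm,
    inv_mul_cancel₀ hf'.ne', inv_mul_cancel₀ hh'.ne', abs_mul, abs_mul, abs_inv, abs_inv,
    abs_norm, abs_norm] at e2
  have e3 : |polar μ ψ f h| = ‖f‖ * ‖h‖ * (‖f‖⁻¹ * (‖h‖⁻¹ * |polar μ ψ f h|)) := by
    field_simp
  rw [e3]
  calc _ ≤ ‖f‖ * ‖h‖ * (C * (1 ^ 2 + 1 ^ 2) / 2) := by gcongr
    _ = _ := by ring

variable [CompleteSpace H]

/-- Riesz representation of the bounded bilinear form `polar μ ψ`. -/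
theorem exists_operator (D : SpectralData μ d T) {ψ : Ω → ℝ} (hψ : IsBddMeas ψ) :
    ∃ S : H →L[ℝ] H, ∀ f h, inner ℝ (S f) h = polar μ ψ f h := by
  obtain ⟨C, h0, hC⟩ := hψ.exists_pos_bound
  have hadd : ∀ f h₁ h₂, polar μ ψ f (h₁ + h₂) = polar μ ψ f h₁ + polar μ ψ f h₂ := by
    intro f h₁ h₂
    rw [D.polar_comm hψ, D.polar_add_left hψ, D.polar_comm hψ h₁, D.polar_comm hψ h₂]
  have hsmul : ∀ (c : ℝ) f h, polar μ ψ f (c • h) = c * polar μ ψ f h := by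
    intro c f h
    rw [D.polar_comm hψ, D.polar_smul_left hψ, D.polar_comm hψ]
  let B : H →L[ℝ] H →L[ℝ] ℝ := (LinearMap.mk₂ ℝ (polar μ ψ) (D.polar_add_left hψ)
    (D.polar_smul_left hψ) hadd hsmul).mkContinuous₂ C
      fun f h => by simpa using D.abs_polar_le hψ h0.le hC f h
  refine ⟨InnerProductSpace.continuousLinearMapOfBilin (𝕜 := ℝ) B, fun f h => ?_⟩
  rw [InnerProductSpace.continuousLinearMapOfBilin_apply]
  rfl

/-- Multiplicativity is extended one factor at a time. It is known for two functions of the family;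
`transfer` frees the left factor, taking adjoints swaps the factors, and a second use of `transfer`
frees the other one. -/
theorem exists_isBorelCalculus (D : SpectralData μ d T) :
    ∃ Φ : (Ω → ℝ) → H →L[ℝ] H, IsBorelCalculus μ Φ ∧ ∀ i, Φ (d i) = T i := by
  classical
  let Φ : (Ω → ℝ) → H →L[ℝ] H := fun ψ =>
    if hψ : IsBddMeas ψ then (D.exists_operator hψ).choose else 0
  have hΦ : ∀ ψ, IsBddMeas ψ → ∀ f h, inner ℝ (Φ ψ f) h = polar μ ψ f h := by
    intro ψ hψ
    simp only [Φ, dif_pos hψ]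
    exact (D.exists_operator hψ).choose_spec
  have hsymm : ∀ ψ, IsBddMeas ψ → ∀ f h, inner ℝ (Φ ψ f) h = inner ℝ f (Φ ψ h) := by
    intro ψ hψ f h
    rw [hΦ ψ hψ, real_inner_comm, hΦ ψ hψ, D.polar_comm hψ]
  have hquad : ∀ ψ, IsBddMeas ψ → ∀ f, inner ℝ (Φ ψ f) f = ∫ x, ψ x ∂(μ f) := by
    intro ψ hψ f
    rw [hΦ ψ hψ, D.polar_self hψ]
  have hT : ∀ i, Φ (d i) = T i := fun i =>
    ext_of_quadratic (hsymm _ (D.bddMeas i)) (D.symm i) fun f => by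
      rw [hquad _ (D.bddMeas i), D.quad]
  have transfer : ∀ (ψ : Ω → ℝ) (R : H →L[ℝ] H), IsBddMeas ψ →
      (∀ j, T j ∘L R = Φ (fun x => d j x * ψ x)) →
      ∀ χ, IsBddMeas χ → Φ (fun x => χ x * ψ x) = Φ χ ∘L R := by
    intro ψ R hψ hR χ hχ
    ext f
    refine ext_inner_right ℝ fun h => ?_
    -- Polarised, the claim compares `χ` on `μ (R f ± h)` with `χ ψ` on `μ (f ± h)`. With the
    -- weights `±1` and `∓ψ` it is linear in `χ`, so it suffices to test on the `d j`, where it is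
    -- `hR`.
    have := D.determines.sum_integral_eq_zero D.bddMeas
      (fun k => μ ((![R f + h, R f - h, f + h, f - h] : Fin 4 → H) k)) (fun k => D.finite _)
      (![fun _ => 1, fun _ => -1, fun x => -ψ x, ψ] : Fin 4 → Ω → ℝ)
      (fun k => by
        fin_cases k
        exacts [IsBddMeas.const _, IsBddMeas.const _, hψ.neg, hψ]) (fun j => ?_) hχ
    · rw [hΦ _ (hχ.mul hψ), ContinuousLinearMap.comp_apply, hΦ _ hχ]
      simp [Fin.sum_univ_succ, integral_neg] at this
      unfold polar
      linarith
    · have h1 := congrArg (fun S : H →L[ℝ] H => inner ℝ (S f) h) (hR j)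
      simp only [ContinuousLinearMap.comp_apply] at h1
      rw [hΦ _ ((D.bddMeas j).mul hψ), ← hT j, hΦ _ (D.bddMeas j)] at h1
      simp [Fin.sum_univ_succ, integral_neg]
      unfold polar at h1
      linarith
  have h1 : ∀ i χ, IsBddMeas χ → Φ (fun x => χ x * d i x) = Φ χ ∘L T i := by
    intro i χ hχ
    refine transfer (d i) (T i) (D.bddMeas i) (fun j => ?_) χ hχ
    obtain ⟨k, hk, hk'⟩ := D.mul j i
    rw [← hk, ← hk', hT]
  have h2 : ∀ i χ, IsBddMeas χ → T i ∘L Φ χ = Φ (fun x => d i x * χ x) := by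
    intro i χ hχ
    ext f
    refine ext_inner_right ℝ fun h => ?_
    rw [ContinuousLinearMap.comp_apply, D.symm, hsymm _ hχ, hsymm _ ((D.bddMeas i).mul hχ)]
    have := congrArg (fun S : H →L[ℝ] H => inner ℝ f (S h)) (h1 i χ hχ)
    simp only [ContinuousLinearMap.comp_apply] at this
    rw [← this]
    simp only [mul_comm]
  exact ⟨Φ, ⟨D.finite, hsymm, hquad, fun ψ χ hψ hχ =>
    transfer χ (Φ χ) hχ (fun j => h2 j χ hχ) ψ hψ⟩, hT⟩

end SpectralData

end Calculus

section

variable {H : Type*} [NormedAddCommGroup H] [InnerProductSpace ℝ H]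

namespace IsBorelCalculus

variable {Ω : Type*} [MeasurableSpace Ω] {μ : H → Measure Ω} {Φ : (Ω → ℝ) → H →L[ℝ] H}
  {ψ χ : Ω → ℝ}

theorem map_add (C : IsBorelCalculus μ Φ) (hψ : IsBddMeas ψ) (hχ : IsBddMeas χ) :
    Φ (fun x => ψ x + χ x) = Φ ψ + Φ χ := by
  refine ext_of_quadratic (C.symm _ (hψ.add hχ)) (fun f h => ?_) fun f => ?_
  · simp [inner_add_left, inner_add_right, C.symm _ hψ, C.symm _ hχ]
  · have := C.finite f
    rw [C.quad _ (hψ.add hχ), integral_add (hψ.integrable _) (hχ.integrable _)]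
    simp [inner_add_left, C.quad _ hψ, C.quad _ hχ]

theorem map_const_mul (C : IsBorelCalculus μ Φ) (c : ℝ) (hψ : IsBddMeas ψ) :
    Φ (fun x => c * ψ x) = c • Φ ψ := by
  refine ext_of_quadratic (C.symm _ (hψ.const_mul c)) (fun f h => ?_) fun f => ?_
  · simp [inner_smul_left, inner_smul_right, C.symm _ hψ]
  · rw [C.quad _ (hψ.const_mul c), integral_const_mul]
    simp [inner_smul_left, C.quad _ hψ]

theorem norm_sq (C : IsBorelCalculus μ Φ) (hψ : IsBddMeas ψ) (f : H) :
    ‖Φ ψ f‖ ^ 2 = ∫ x, ψ x ^ 2 ∂(μ f) := by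
  rw [← real_inner_self_eq_norm_sq, ← C.symm _ hψ, ← ContinuousLinearMap.comp_apply,
    ← C.mul _ _ hψ hψ, C.quad _ (hψ.mul hψ)]
  simp only [pow_two]

theorem map_sub (C : IsBorelCalculus μ Φ) (hψ : IsBddMeas ψ) (hχ : IsBddMeas χ) :
    Φ (fun x => ψ x - χ x) = Φ ψ - Φ χ := by
  have := C.map_add hψ (hχ.const_mul (-1))
  rw [C.map_const_mul _ hχ, neg_one_smul, ← sub_eq_add_neg] at this
  rw [← this]
  congr 1
  ext s
  ring

/-- Since `‖Φ ψ f‖` is the `L²(μ f)` norm of `ψ`, strong convergence of the operators is `L²`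
convergence of the symbols, which follows by dominated convergence. -/
theorem tendsto (C : IsBorelCalculus μ Φ) {α : Type*} {l : Filter α} [l.IsCountablyGenerated]
    {Ψ : α → Ω → ℝ} {f : H} {B : ℝ} (hΨ : ∀ᶠ a in l, IsBddMeas (Ψ a)) (hψ : IsBddMeas ψ)
    (hB : ∀ᶠ a in l, ∀ᵐ x ∂(μ f), |Ψ a x| ≤ B)
    (hlim : ∀ᵐ x ∂(μ f), Tendsto (fun a => Ψ a x) l (𝓝 (ψ x))) :
    Tendsto (fun a => Φ (Ψ a) f) l (𝓝 (Φ ψ f)) := by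
  obtain ⟨D, hD⟩ := hψ.bdd
  have := C.finite f
  have key : Tendsto (fun a => ∫ x, (Ψ a x - ψ x) ^ 2 ∂(μ f)) l (𝓝 (∫ _, (0 : ℝ) ∂(μ f))) := by
    refine tendsto_integral_filter_of_dominated_convergence (fun _ => (B + D) ^ 2) ?_ ?_
      (integrable_const _) ?_
    · filter_upwards [hΨ] with a ha
      exact (ha.sub hψ).sq.measurable.aestronglyMeasurable
    · filter_upwards [hB] with a ha
      filter_upwards [ha] with x hx
      rw [norm_pow, Real.norm_eq_abs]
      refine pow_le_pow_left₀ (abs_nonneg _) ?_ 2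
      exact (abs_sub _ _).trans (add_le_add hx (hD x))
    · filter_upwards [hlim] with x hx
      simpa using (hx.sub_const (ψ x)).pow 2
  rw [integral_zero] at key
  rw [tendsto_iff_norm_sub_tendsto_zero]
  have h2 : Tendsto (fun a => ‖Φ (Ψ a) f - Φ ψ f‖ ^ 2) l (𝓝 0) := by
    refine key.congr' ?_
    filter_upwards [hΨ] with a ha
    rw [← C.norm_sq (ha.sub hψ), C.map_sub ha hψ]
    rfl
  simpa using h2.sqrt

end IsBorelCalculus

end

/-! ### The bounded functional calculus of a spectral family. -/

section

variable {H : Type*} [NormedAddCommGroup H] [InnerProductSpace ℝ H] [CompleteSpace H]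

namespace SpectralFamily

variable (E : SpectralFamily H)

theorem stieltjes_tendsto_atBot (f : H) : Tendsto (E.stieltjes f) atBot (𝓝 0) := by
  refine tendsto_const_nhds.congr' ?_
  filter_upwards [eventually_lt_atBot 0] with s hs
  change 0 = inner ℝ (E.proj s f) f
  simp [E.proj_of_neg s hs]

theorem stieltjes_tendsto_atTop (f : H) : Tendsto (E.stieltjes f) atTop (𝓝 (‖f‖ ^ 2)) := by
  rw [← real_inner_self_eq_norm_sq]
  exact (E.tendsto_atTop f).inner tendsto_const_nhds

instance isFiniteMeasure_measure (f : H) : IsFiniteMeasure (E.measure f) :=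
  StieltjesFunction.isFiniteMeasure _ (E.stieltjes_tendsto_atBot f) (E.stieltjes_tendsto_atTop f)

theorem measure_real_Iic (f : H) (s : ℝ) : (E.measure f).real (Iic s) = inner ℝ (E.proj s f) f := by
  rw [measureReal_def, measure, StieltjesFunction.measure_Iic _ (E.stieltjes_tendsto_atBot f),
    sub_zero]
  refine ENNReal.toReal_ofReal ?_
  change 0 ≤ inner ℝ (E.proj s f) f
  rw [inner_proj_self]
  positivity

theorem measure_real_univ (f : H) : (E.measure f).real univ = ‖f‖ ^ 2 := by
  rw [measureReal_def, measure, StieltjesFunction.measure_univ _ (E.stieltjes_tendsto_atBot f)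
    (E.stieltjes_tendsto_atTop f), sub_zero]
  exact ENNReal.toReal_ofReal (by positivity)

theorem measure_Iio_zero (f : H) : E.measure f (Iio 0) = 0 := by
  rw [measure, StieltjesFunction.measure_Iio _ (E.stieltjes_tendsto_atBot f), sub_zero]
  have : Function.leftLim (E.stieltjes f) 0 = 0 := by
    refine leftLim_eq_of_tendsto (tendsto_const_nhds.congr' ?_)
    filter_upwards [self_mem_nhdsWithin] with s hs
    change 0 = inner ℝ (E.proj s f) f
    simp [E.proj_of_neg s hs]
  rw [this, ENNReal.ofReal_zero]

theorem ae_nonneg (f : H) : ∀ᵐ s ∂(E.measure f), s ∈ Ici (0 : ℝ) := by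
  rw [ae_iff]
  convert E.measure_Iio_zero f using 2
  ext s
  simp

theorem restrict_Ici (f : H) : (E.measure f).restrict (Ici 0) = E.measure f :=
  Measure.restrict_eq_self_of_ae_mem (E.ae_nonneg f)

theorem proj_symm (s : ℝ) (f h : H) : inner ℝ (E.proj s f) h = inner ℝ f (E.proj s h) :=
  (ContinuousLinearMap.isSelfAdjoint_iff_isSymmetric.mp (E.isStarProjection s).isSelfAdjoint) f h

theorem proj_comp' (r s : ℝ) (h : r ≤ s) : E.proj s ∘L E.proj r = E.proj r := by
  ext f
  refine ext_inner_right ℝ fun v => ?_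
  rw [ContinuousLinearMap.comp_apply, E.proj_symm, E.proj_symm, E.proj_symm]
  congr 1
  exact DFunLike.congr_fun (E.proj_comp r s h) v

end SpectralFamily

theorem isBddMeas_indicator_one {Ω : Type*} [MeasurableSpace Ω] {s : Set Ω}
    (hs : MeasurableSet s) : IsBddMeas (s.indicator fun _ => (1 : ℝ)) :=
  (IsBddMeas.const 1).indicator hs

theorem determines_indicator_Iic :
    Determines (fun s : ℝ => (Iic s).indicator fun _ => (1 : ℝ)) := by
  intro ν₁ ν₂ _ _ h
  refine Measure.ext_of_Iic _ _ fun s => ?_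
  have := h s
  rw [integral_indicator_const _ measurableSet_Iic, integral_indicator_const _ measurableSet_Iic,
    smul_eq_mul, smul_eq_mul, mul_one, mul_one] at this
  exact (measureReal_eq_measureReal_iff).mp this

namespace SpectralFamily

variable (E : SpectralFamily H)

/-- The indicators of half-lines are closed under products, matching `E_r E_s = E_{min r s}`, so the
abstract calculus applies to a spectral family. -/
theorem spectralData :
    SpectralData E.measure (fun s : ℝ => (Iic s).indicator fun _ => (1 : ℝ)) E.proj where
  finite := inferInstance
  mass f := (E.measure_real_univ f).le
  bddMeas s := isBddMeas_indicator_one measurableSet_Iic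
  determines := determines_indicator_Iic
  symm := E.proj_symm
  quad s f := by
    rw [integral_indicator_const _ measurableSet_Iic, E.measure_real_Iic, smul_eq_mul, mul_one]
  mul r s := by
    refine ⟨min r s, ?_, ?_⟩
    · ext x
      by_cases h1 : x ≤ r <;> by_cases h2 : x ≤ s <;> simp [indicator, h1, h2]
    · rcases le_total r s with h | h
      · rw [min_eq_left h, E.proj_comp r s h]
      · rw [min_eq_right h, E.proj_comp' s r h]

/-- The operator `∫_{[0,∞)} ψ dE` for bounded measurable `ψ`. -/
def op (ψ : ℝ → ℝ) : H →L[ℝ] H := E.spectralData.exists_isBorelCalculus.choose ((Ici 0).indicator ψ)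

end SpectralFamily

/-- Functions that are bounded and measurable on `[0, ∞)`. -/
def BddOn (ψ : ℝ → ℝ) : Prop := IsBddMeas ((Ici (0 : ℝ)).indicator ψ)

namespace BddOn

variable {ψ χ : ℝ → ℝ}

theorem of_continuousOn (hψ : ContinuousOn ψ (Ici 0)) {C : ℝ} (hC : ∀ s, 0 ≤ s → |ψ s| ≤ C) :
    BddOn ψ := by
  refine ⟨?_, C, fun s => ?_⟩
  -- Nothing is known about `ψ` on the negative axis; composing with `max s 0` gives a function
  -- continuous on all of `ℝ` with the same restriction to `[0, ∞)`.
  · have h : (Ici (0 : ℝ)).indicator ψ = (Ici (0 : ℝ)).indicator (fun s => ψ (max s 0)) := by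
      ext s
      by_cases hs : 0 ≤ s <;> simp [indicator, hs]
    rw [h]
    refine Measurable.indicator (Continuous.measurable ?_) measurableSet_Ici
    exact hψ.comp_continuous (by fun_prop) fun s => mem_Ici.mpr (le_max_right _ _)
  · by_cases hs : 0 ≤ s
    · simpa [indicator, hs] using hC s hs
    · simpa [indicator, hs] using (abs_nonneg _).trans (hC 0 le_rfl)

theorem const (c : ℝ) : BddOn fun _ => c := (IsBddMeas.const c).indicator measurableSet_Ici

theorem mul (hψ : BddOn ψ) (hχ : BddOn χ) : BddOn fun s => ψ s * χ s := by
  have := IsBddMeas.mul hψ hχ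
  rwa [← indicator_mul] at this

theorem add (hψ : BddOn ψ) (hχ : BddOn χ) : BddOn fun s => ψ s + χ s := by
  have := IsBddMeas.add hψ hχ
  rwa [← indicator_add] at this

theorem const_mul (c : ℝ) (hψ : BddOn ψ) : BddOn fun s => c * ψ s := (const c).mul hψ

theorem sub (hψ : BddOn ψ) (hχ : BddOn χ) : BddOn fun s => ψ s - χ s := by
  simpa [sub_eq_add_neg] using hψ.add (hχ.const_mul (-1))

theorem indicator (hψ : BddOn ψ) {A : Set ℝ} (hA : MeasurableSet A) : BddOn (A.indicator ψ) := by
  unfold BddOn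
  rw [indicator_indicator, inter_comm, ← indicator_indicator]
  exact IsBddMeas.indicator hψ hA

/-- Continuity bounds `ψ` on the compact interval `[0, n]`. These truncations are the bounded
approximants of an unbounded symbol. -/
theorem cut (hψ : ContinuousOn ψ (Ici 0)) (n : ℝ) : BddOn ((Iic n).indicator ψ) := by
  obtain ⟨C, hC⟩ := (isCompact_Icc (a := (0 : ℝ)) (b := n)).exists_bound_of_continuousOn
    (hψ.mono Icc_subset_Ici_self)
  refine ⟨?_, max C 0, fun s => ?_⟩
  · have h : (Ici (0 : ℝ)).indicator ((Iic n).indicator ψ) =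
        (Ici (0 : ℝ)).indicator ((Iic n).indicator (fun s => ψ (max s 0))) := by
      ext s
      by_cases hs : 0 ≤ s <;> simp [Set.indicator, hs]
    rw [h]
    refine ((Continuous.measurable ?_).indicator measurableSet_Iic).indicator measurableSet_Ici
    exact hψ.comp_continuous (by fun_prop) fun s => mem_Ici.mpr (le_max_right _ _)
  · by_cases hs : s ∈ Icc 0 n
    · have h1 : (0 : ℝ) ≤ s := hs.1
      have h2 : s ≤ n := hs.2
      simpa [Set.indicator, h1, h2] using Or.inl (hC s hs)
    · rw [indicator_indicator, show Ici (0 : ℝ) ∩ Iic n = Icc 0 n from rfl, indicator_of_notMem hs]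
      simp

end BddOn

namespace SpectralFamily

variable (E : SpectralFamily H) {ψ χ : ℝ → ℝ}

theorem isBorelCalculus :
    IsBorelCalculus E.measure E.spectralData.exists_isBorelCalculus.choose :=
  E.spectralData.exists_isBorelCalculus.choose_spec.1

theorem op_symm (hψ : BddOn ψ) (f h : H) : inner ℝ (E.op ψ f) h = inner ℝ f (E.op ψ h) :=
  E.isBorelCalculus.symm _ hψ f h

theorem integral_indicator_Ici (ψ : ℝ → ℝ) (f : H) :
    ∫ s, (Ici (0 : ℝ)).indicator ψ s ∂(E.measure f) = ∫ s, ψ s ∂(E.measure f) := by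
  rw [integral_indicator measurableSet_Ici, E.restrict_Ici]

theorem op_quad (hψ : BddOn ψ) (f : H) : inner ℝ (E.op ψ f) f = ∫ s, ψ s ∂(E.measure f) := by
  rw [op, E.isBorelCalculus.quad _ hψ, E.integral_indicator_Ici]

theorem op_congr (h : ∀ s, 0 ≤ s → ψ s = χ s) : E.op ψ = E.op χ := by
  rw [op, op, indicator_congr (s := Ici (0 : ℝ)) h]

theorem op_mul (hψ : BddOn ψ) (hχ : BddOn χ) : E.op (fun s => ψ s * χ s) = E.op ψ ∘L E.op χ := by
  rw [op, op, op, ← E.isBorelCalculus.mul _ _ hψ hχ, indicator_mul]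

theorem op_mul_apply (hψ : BddOn ψ) (hχ : BddOn χ) (f : H) :
    E.op (fun s => ψ s * χ s) f = E.op ψ (E.op χ f) := by
  rw [E.op_mul hψ hχ, ContinuousLinearMap.comp_apply]

theorem op_comm (hψ : BddOn ψ) (hχ : BddOn χ) (f : H) :
    E.op ψ (E.op χ f) = E.op χ (E.op ψ f) := by
  rw [← E.op_mul_apply hψ hχ, ← E.op_mul_apply hχ hψ]
  simp only [mul_comm]

theorem op_add (hψ : BddOn ψ) (hχ : BddOn χ) : E.op (fun s => ψ s + χ s) = E.op ψ + E.op χ := by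
  rw [op, op, op, ← E.isBorelCalculus.map_add hψ hχ, indicator_add]

theorem op_const_mul (c : ℝ) (hψ : BddOn ψ) : E.op (fun s => c * ψ s) = c • E.op ψ := by
  rw [op, op, ← E.isBorelCalculus.map_const_mul c hψ]
  refine congrArg _ (funext fun s => ?_)
  by_cases hs : 0 ≤ s <;> simp [indicator, hs]

theorem op_sub (hψ : BddOn ψ) (hχ : BddOn χ) : E.op (fun s => ψ s - χ s) = E.op ψ - E.op χ := by
  rw [op, op, op, ← E.isBorelCalculus.map_sub hψ hχ, indicator_sub]

theorem op_norm_sq (hψ : BddOn ψ) (f : H) : ‖E.op ψ f‖ ^ 2 = ∫ s, ψ s ^ 2 ∂(E.measure f) := by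
  rw [op, E.isBorelCalculus.norm_sq hψ, ← E.integral_indicator_Ici fun s => ψ s ^ 2]
  congr 1
  ext s
  by_cases hs : 0 ≤ s <;> simp [indicator, hs]

theorem op_one : E.op (fun _ => 1) = ContinuousLinearMap.id ℝ H := by
  refine ext_of_quadratic (E.op_symm (.const 1)) (fun _ _ => rfl) fun f => ?_
  rw [E.op_quad (.const 1)]
  simp [E.measure_real_univ]

theorem op_indicator_Iic (s : ℝ) : E.op ((Iic s).indicator fun _ => 1) = E.proj s := by
  refine ext_of_quadratic (E.op_symm ((BddOn.const 1).indicator measurableSet_Iic))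
    (E.proj_symm s) fun f => ?_
  rw [E.op_quad ((BddOn.const 1).indicator measurableSet_Iic)]
  exact E.spectralData.quad s f

theorem proj_op (hψ : BddOn ψ) (n : ℝ) (f : H) :
    E.proj n (E.op ψ f) = E.op ((Iic n).indicator ψ) f := by
  rw [← E.op_indicator_Iic, ← E.op_mul_apply ((BddOn.const 1).indicator measurableSet_Iic) hψ]
  congr 2
  ext s
  by_cases h : s ≤ n <;> simp [indicator, h]

theorem op_proj (hψ : BddOn ψ) (n : ℝ) (f : H) :
    E.op ψ (E.proj n f) = E.op ((Iic n).indicator ψ) f := by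
  rw [← E.proj_op hψ, ← E.op_indicator_Iic,
    E.op_comm ((BddOn.const 1).indicator measurableSet_Iic) hψ]

theorem tendsto_op {α : Type*} {l : Filter α} [l.IsCountablyGenerated] {Ψ : α → ℝ → ℝ} {C : ℝ}
    (hΨ : ∀ᶠ a in l, BddOn (Ψ a)) (hψ : BddOn ψ) (hC : ∀ᶠ a in l, ∀ s, 0 ≤ s → |Ψ a s| ≤ C)
    (hlim : ∀ s, 0 ≤ s → Tendsto (fun a => Ψ a s) l (𝓝 (ψ s))) (f : H) :
    Tendsto (fun a => E.op (Ψ a) f) l (𝓝 (E.op ψ f)) := by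
  refine E.isBorelCalculus.tendsto (B := C) hΨ hψ ?_ ?_
  · filter_upwards [hC] with a ha
    filter_upwards [E.ae_nonneg f] with s hs
    simpa only [indicator_of_mem hs] using ha s hs
  · filter_upwards [E.ae_nonneg f] with s hs
    simpa only [indicator_of_mem hs] using hlim s hs

/-! ### Domains and unbounded integrals, by truncation. -/

theorem measure_neg (f : H) : E.measure (-f) = E.measure f := by
  unfold measure
  congr 1
  ext s
  change inner ℝ (E.proj s (-f)) (-f) = inner ℝ (E.proj s f) f
  simp

/-- The mass of `A` is the squared norm of the image under the operator with symbol `1_A`, and `‖a +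
b‖² ≤ 2 ‖a‖² + 2 ‖b‖²`. Closure of the domains under sums follows. -/
theorem measure_add_le (f h : H) :
    E.measure (f + h) ≤ (2 : ENNReal) • E.measure f + (2 : ENNReal) • E.measure h := by
  have key : ∀ A, MeasurableSet A → ∀ k : H,
      E.measure k A = ENNReal.ofReal (‖E.op (A.indicator fun _ => 1) k‖ ^ 2) := by
    intro A hA k
    rw [E.op_norm_sq ((BddOn.const 1).indicator hA)]
    have : ∫ s, (A.indicator (fun _ => (1 : ℝ)) s) ^ 2 ∂(E.measure k) = (E.measure k).real A := by
      rw [← integral_indicator_one hA]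
      congr 1
      ext s
      by_cases h : s ∈ A <;> simp [h]
    rw [this, ofReal_measureReal]
  rw [Measure.le_iff]
  intro A hA
  rw [Measure.add_apply, Measure.smul_apply, Measure.smul_apply, key A hA, key A hA, key A hA,
    smul_eq_mul, smul_eq_mul, show (2 : ENNReal) = ENNReal.ofReal 2 by simp,
    ← ENNReal.ofReal_mul (by norm_num), ← ENNReal.ofReal_mul (by norm_num),
    ← ENNReal.ofReal_add (by positivity) (by positivity), map_add]
  refine ENNReal.ofReal_le_ofReal ?_
  set a := E.op (A.indicator fun _ => 1) f
  set b := E.op (A.indicator fun _ => 1) h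
  nlinarith [parallelogram_law_with_norm ℝ a b, sq_nonneg ‖a - b‖]

theorem mem_domain_iff (f : H) :
    f ∈ E.domain ψ ↔ Integrable (fun s => ψ s ^ 2) (E.measure f) := by
  rw [domain, mem_ofPred_eq, IntegrableOn, E.restrict_Ici]

theorem add_mem_domain {f h : H} (hf : f ∈ E.domain ψ) (hh : h ∈ E.domain ψ) :
    f + h ∈ E.domain ψ := by
  rw [mem_domain_iff] at *
  exact ((hf.smul_measure (by simp)).add_measure (hh.smul_measure (by simp))).mono_measure
    (E.measure_add_le f h)

theorem sub_mem_domain {f h : H} (hf : f ∈ E.domain ψ) (hh : h ∈ E.domain ψ) :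
    f - h ∈ E.domain ψ := by
  rw [sub_eq_add_neg]
  refine E.add_mem_domain hf ?_
  rw [mem_domain_iff] at *
  rwa [E.measure_neg]

theorem aestronglyMeasurable (hψ : ContinuousOn ψ (Ici 0)) (f : H) :
    AEStronglyMeasurable ψ (E.measure f) := by
  rw [← E.restrict_Ici]
  exact hψ.aestronglyMeasurable measurableSet_Ici

theorem tendsto_integral_cut (hψ : ContinuousOn ψ (Ici 0)) {f : H} (hf : f ∈ E.domain ψ) :
    Tendsto (fun n : ℕ => ∫ s, (Iic (n : ℝ)).indicator ψ s ∂(E.measure f)) atTop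
      (𝓝 (∫ s, ψ s ∂(E.measure f))) := by
  rw [mem_domain_iff] at hf
  -- The domain condition controls `ψ²` only; as the measure is finite, `|ψ| ≤ 1 + ψ²` is an
  -- integrable bound.
  refine tendsto_integral_of_dominated_convergence (fun s => 1 + ψ s ^ 2) (fun n => ?_)
    ((integrable_const 1).add hf) (fun n => ae_of_all _ fun s => ?_) (ae_of_all _ fun s => ?_)
  · exact (E.aestronglyMeasurable hψ f).indicator measurableSet_Iic
  · refine (norm_indicator_le_norm_self _ _).trans ?_
    rw [Real.norm_eq_abs]
    nlinarith [sq_abs (ψ s), sq_nonneg (|ψ s| - 1)]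
  · refine tendsto_const_nhds.congr' ?_
    filter_upwards [eventually_ge_atTop ⌈s⌉₊] with n hn
    rw [indicator_of_mem]
    exact (Nat.le_ceil s).trans (by exact_mod_cast hn)

theorem inner_op_eq (hψ : BddOn ψ) (f h : H) : inner ℝ (E.op ψ f) h =
    ((∫ s, ψ s ∂(E.measure (f + h))) - ∫ s, ψ s ∂(E.measure (f - h))) / 4 := by
  rw [inner_eq_polar (E.op_symm hψ), E.op_quad hψ, E.op_quad hψ]

theorem tendsto_inner_op_cut (hψ : ContinuousOn ψ (Ici 0)) {f h : H} (hf : f ∈ E.domain ψ)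
    (hh : h ∈ E.domain ψ) :
    Tendsto (fun n : ℕ => inner ℝ (E.op ((Iic (n : ℝ)).indicator ψ) f) h) atTop
      (𝓝 (E.integral ψ f h)) := by
  unfold integral
  simp only [E.inner_op_eq (BddOn.cut hψ _), E.restrict_Ici]
  exact ((E.tendsto_integral_cut hψ (E.add_mem_domain hf hh)).sub
    (E.tendsto_integral_cut hψ (E.sub_mem_domain hf hh))).div_const 4

theorem tendsto_proj_nat (f : H) : Tendsto (fun n : ℕ => E.proj n f) atTop (𝓝 f) :=
  (E.tendsto_atTop f).comp tendsto_natCast_atTop_atTop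

theorem eq_of_forall_proj_eq {u v : H} (h : ∀ n : ℕ, E.proj n u = E.proj n v) : u = v :=
  tendsto_nhds_unique (E.tendsto_proj_nat u) (by simpa only [h] using E.tendsto_proj_nat v)

theorem proj_op_cut (hψ : ContinuousOn ψ (Ici 0)) {n m : ℝ} (hnm : n ≤ m) (f : H) :
    E.proj n (E.op ((Iic m).indicator ψ) f) = E.op ((Iic n).indicator ψ) f := by
  rw [E.proj_op (BddOn.cut hψ m), indicator_indicator, Iic_inter_Iic, min_eq_left hnm]

theorem mem_domain_of_bound (hψ : ContinuousOn ψ (Ici 0)) {f : H} {I : ℝ}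
    (h : ∀ n : ℕ, ‖E.op ((Iic (n : ℝ)).indicator ψ) f‖ ^ 2 ≤ I) : f ∈ E.domain ψ := by
  rw [mem_domain_iff]
  have hcover : AECover (E.measure f) atTop fun n : ℕ => Iic (n : ℝ) :=
    aecover_Iic tendsto_natCast_atTop_atTop
  have hsq : ∀ n : ℕ, (fun s => ((Iic (n : ℝ)).indicator ψ s) ^ 2) =
      (Iic (n : ℝ)).indicator fun s => ψ s ^ 2 := by
    intro n
    ext s
    by_cases h : s ≤ n <;> simp [indicator, h]
  refine hcover.integrable_of_integral_bounded_of_nonneg_ae I (fun n => ?_)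
    (ae_of_all _ fun s => sq_nonneg _) (Eventually.of_forall fun n => ?_)
  · rw [← integrable_indicator_iff measurableSet_Iic, ← hsq n]
    have h1 := ((BddOn.cut hψ n).mul (BddOn.cut hψ n)).integrable (E.measure f)
    rw [integrable_indicator_iff measurableSet_Ici, IntegrableOn, E.restrict_Ici] at h1
    simpa only [pow_two] using h1
  · have := h n
    rw [E.op_norm_sq (BddOn.cut hψ n), hsq, integral_indicator measurableSet_Iic] at this
    exact this

/-- Truncating at `m` after `E_n` amounts to `E_m` applied to the truncation at `n`, which is
bounded independently of `m`. -/
theorem proj_mem_domain (hψ : ContinuousOn ψ (Ici 0)) (n : ℕ) (f : H) :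
    E.proj n f ∈ E.domain ψ := by
  refine E.mem_domain_of_bound hψ (I := (‖E.op ((Iic (n : ℝ)).indicator ψ)‖ * ‖f‖) ^ 2)
    fun m => ?_
  rw [E.op_proj (BddOn.cut hψ m)]
  have : E.op ((Iic (n : ℝ)).indicator ((Iic (m : ℝ)).indicator ψ)) f =
      E.proj m (E.op ((Iic (n : ℝ)).indicator ψ) f) := by
    rw [E.proj_op (BddOn.cut hψ n), indicator_indicator, indicator_indicator, inter_comm]
  rw [this]
  refine pow_le_pow_left₀ (norm_nonneg _) ?_ 2
  exact (E.norm_proj_le _ _).trans (ContinuousLinearMap.le_opNorm _ _)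

/-- Testing against `E_n h`, which lies in the domain, makes the truncated pairings constant from
level `n` on. Conversely the truncated images `E_n u` of `f` have norm at most `‖u‖`, which puts `f`
in the domain, and `n → ∞` recovers the pairing. Equations between unbounded operators are thereby
checked after applying every `E_n`. -/
theorem isIntegral_iff (hψ : ContinuousOn ψ (Ici 0)) (f u : H) :
    E.IsIntegral ψ f u ↔ ∀ n : ℕ, E.proj n u = E.op ((Iic (n : ℝ)).indicator ψ) f := by
  constructor
  · rintro ⟨hf, hu⟩ n
    refine ext_inner_right ℝ fun h => ?_
    have h1 := E.tendsto_inner_op_cut hψ hf (E.proj_mem_domain hψ n h)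
    rw [← hu _ (E.proj_mem_domain hψ n h), ← E.proj_symm] at h1
    refine tendsto_nhds_unique h1 (tendsto_const_nhds.congr' ?_)
    filter_upwards [eventually_ge_atTop n] with m hm
    rw [← E.proj_symm, E.proj_op_cut hψ (by exact_mod_cast hm)]
  · intro h
    have hf : f ∈ E.domain ψ := E.mem_domain_of_bound hψ (I := ‖u‖ ^ 2) fun n => by
      rw [← h]
      exact pow_le_pow_left₀ (norm_nonneg _) (E.norm_proj_le _ _) 2
    refine ⟨hf, fun k hk => ?_⟩
    have h1 := E.tendsto_inner_op_cut hψ hf hk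
    simp only [← h] at h1
    exact tendsto_nhds_unique ((E.tendsto_proj_nat u).inner tendsto_const_nhds) h1

theorem isIntegral_op (hψ : ContinuousOn ψ (Ici 0)) (hb : BddOn ψ) (f : H) :
    E.IsIntegral ψ f (E.op ψ f) :=
  (E.isIntegral_iff hψ f _).mpr fun n => E.proj_op hb n f

end SpectralFamily

end

/-! ### Contraction semigroups and their generators. -/

section

variable {H : Type*} [NormedAddCommGroup H] [InnerProductSpace ℝ H]

/-- A strongly continuous semigroup of contractions. -/
structure IsContractionSemigroup (P : NNReal → H →L[ℝ] H) : Prop where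
  zero : P 0 = ContinuousLinearMap.id ℝ _
  add : ∀ s t, P (s + t) = P s ∘L P t
  strongly_continuous : ∀ f, Tendsto (fun t => P t f) (𝓝[>] 0) (𝓝 f)
  norm_le : ∀ t f, ‖P t f‖ ≤ ‖f‖

namespace IsContractionSemigroup

variable {P Q : NNReal → H →L[ℝ] H}

theorem norm_sub_le_of_le (hP : IsContractionSemigroup P) {s t : NNReal} (h : s ≤ t) (f : H) :
    ‖P t f - P s f‖ ≤ ‖P (t - s) f - f‖ := by
  have : P t f - P s f = P s (P (t - s) f - f) := by
    rw [map_sub, ← ContinuousLinearMap.comp_apply, ← hP.add, add_tsub_cancel_of_le h]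
  rw [this]
  exact hP.norm_le _ _

theorem norm_sub_le (hP : IsContractionSemigroup P) (s t : NNReal) (f : H) :
    ‖P t f - P s f‖ ≤ ‖P (nndist t s) f - f‖ := by
  rcases le_total s t with h | h
  · have : nndist t s = t - s := by rw [NNReal.nndist_eq, tsub_eq_zero_of_le h]; simp
    rw [this]
    exact hP.norm_sub_le_of_le h f
  · have : nndist t s = s - t := by rw [NNReal.nndist_eq, tsub_eq_zero_of_le h]; simp
    rw [this, norm_sub_rev]
    exact hP.norm_sub_le_of_le h f

theorem tendsto_zero (hP : IsContractionSemigroup P) (f : H) :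
    Tendsto (fun t => P t f) (𝓝 0) (𝓝 f) := by
  have h1 : ContinuousWithinAt (fun t => P t f) (Ioi 0) 0 := by
    have := hP.strongly_continuous f
    rw [ContinuousWithinAt]
    simpa [hP.zero] using this
  have h2 := h1.insert
  rw [Ioi_insert, show Ici (0 : NNReal) = univ from by ext; simp, continuousWithinAt_univ] at h2
  have h3 := h2.tendsto
  simpa [hP.zero] using h3

theorem continuous_apply (hP : IsContractionSemigroup P) (f : H) : Continuous fun t => P t f := by
  rw [continuous_iff_continuousAt]
  intro s
  rw [ContinuousAt, tendsto_iff_norm_sub_tendsto_zero]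
  have h1 : Tendsto (fun t => nndist t s) (𝓝 s) (𝓝 0) := by
    have : Continuous fun t => nndist t s := by fun_prop
    simpa using this.tendsto s
  have h2 := ((hP.tendsto_zero f).comp h1).sub_const f
  refine squeeze_zero (fun _ => norm_nonneg _) (fun t => hP.norm_sub_le s t f) ?_
  simpa using h2.norm

theorem continuous_uncurry (hP : IsContractionSemigroup P) :
    Continuous fun p : NNReal × H => P p.1 p.2 := by
  rw [continuous_iff_continuousAt]
  rintro ⟨s, y⟩
  rw [ContinuousAt, tendsto_iff_norm_sub_tendsto_zero]
  have h1 : Tendsto (fun p : NNReal × H => ‖p.2 - y‖ + ‖P p.1 y - P s y‖) (𝓝 (s, y)) (𝓝 0) := by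
    have : Continuous fun p : NNReal × H => ‖p.2 - y‖ + ‖P p.1 y - P s y‖ := by
      have := (hP.continuous_apply y).comp (continuous_fst (X := NNReal) (Y := H))
      exact (continuous_snd.sub continuous_const).norm.add (this.sub continuous_const).norm
    simpa using this.tendsto (s, y)
  refine squeeze_zero (fun _ => norm_nonneg _) (fun p => ?_) h1
  have : P p.1 p.2 - P s y = P p.1 (p.2 - y) + (P p.1 y - P s y) := by
    rw [map_sub]; abel
  rw [this]
  exact (norm_add_le _ _).trans (add_le_add_left (hP.norm_le _ _) _)

/-- With `v = Q x f` and `h = y - x`, the increment is `P (T - y) (Q h v - P h v)`. Contractivity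
removes the outer factor, and the two difference quotients at `v` share the limit `a`. -/
theorem hasDerivWithinAt_interpolation (hP : IsContractionSemigroup P)
    (hQ : IsContractionSemigroup Q) (T : NNReal) (f a : H) {x : ℝ} (hx : x ∈ Ico 0 (T : ℝ))
    (h1 : IsGeneratorValue P (Q x.toNNReal f) a) (h2 : IsGeneratorValue Q (Q x.toNNReal f) a) :
    HasDerivWithinAt (fun s : ℝ => P (T - s.toNNReal) (Q s.toNNReal f)) 0 (Ici x) x := by
  rw [← hasDerivWithinAt_Ioi_iff_Ici, hasDerivWithinAt_iff_tendsto_slope' self_notMem_Ioi]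
  have hlim : Tendsto (fun y : ℝ => (y - x).toNNReal) (𝓝[>] x) (𝓝[>] 0) := by
    rw [tendsto_nhdsWithin_iff]
    constructor
    · have : Continuous fun y : ℝ => (y - x).toNNReal := by fun_prop
      simpa using (this.tendsto x).mono_left nhdsWithin_le_nhds
    · filter_upwards [self_mem_nhdsWithin] with y hy
      simpa using hy
  have h3 := ((h2.sub h1).comp hlim).norm
  rw [sub_self, norm_zero] at h3
  refine squeeze_zero_norm' ?_ h3
  filter_upwards [Ioo_mem_nhdsGT hx.2] with y hy
  set h := (y - x).toNNReal with hh
  have hy0 : 0 ≤ y := hx.1.trans hy.1.le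
  have ex : y.toNNReal = x.toNNReal + h := by
    rw [hh, ← Real.toNNReal_add hx.1 (by linarith [hy.1])]
    congr 1
    ring
  have hyT : y.toNNReal ≤ T := Real.toNNReal_le_iff_le_coe.mpr hy.2.le
  have eT : T - x.toNNReal = (T - y.toNNReal) + h := by
    have e1 := tsub_add_cancel_of_le hyT
    rw [ex] at e1 ⊢
    conv_lhs => rw [← e1]
    rw [add_comm x.toNNReal h, ← add_assoc, add_tsub_cancel_right]
  have ev : P (T - y.toNNReal) (Q y.toNNReal f) - P (T - x.toNNReal) (Q x.toNNReal f) =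
      P (T - y.toNNReal) (Q h (Q x.toNNReal f) - P h (Q x.toNNReal f)) := by
    have eQ : Q y.toNNReal f = Q h (Q x.toNNReal f) := by
      rw [ex, add_comm, hQ.add, ContinuousLinearMap.comp_apply]
    rw [eQ, eT, hP.add, map_sub, ContinuousLinearMap.comp_apply]
  have hc : ((h : NNReal) : ℝ) = y - x := by
    rw [hh, Real.coe_toNNReal _ (by linarith [hy.1])]
  rw [slope_def_module, ev, ← map_smul]
  refine (hP.norm_le _ _).trans (le_of_eq ?_)
  simp only [Function.comp_apply, ← hh, hc, ← smul_sub]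
  congr 2
  abel

/-- The interpolation `s ↦ P (T - s) (Q s f)` is continuous with zero right derivative, hence
constant; its end values are `P T f` and `Q T f`. -/
theorem eq_of_generator (hP : IsContractionSemigroup P) (hQ : IsContractionSemigroup Q) (f : H)
    (h : ∀ t, ∃ a, IsGeneratorValue P (Q t f) a ∧ IsGeneratorValue Q (Q t f) a) (T : NNReal) :
    Q T f = P T f := by
  have hcont : Continuous fun s : ℝ => P (T - s.toNNReal) (Q s.toNNReal f) := by
    have h1 : Continuous fun s : ℝ => (T - s.toNNReal, Q s.toNNReal f) :=
      (continuous_const.sub continuous_real_toNNReal).prodMk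
        ((hQ.continuous_apply f).comp continuous_real_toNNReal)
    exact hP.continuous_uncurry.comp h1
  have := constant_of_has_deriv_right_zero hcont.continuousOn (a := 0) (b := T) (fun x hx => by
    obtain ⟨a, h1, h2⟩ := h x.toNNReal
    exact hP.hasDerivWithinAt_interpolation hQ T f a hx h1 h2) T ⟨T.2, le_rfl⟩
  simpa [hP.zero, hQ.zero] using this

end IsContractionSemigroup

end

/-! ### The semigroup of a spectral family and its generator. -/

section

variable {H : Type*} [NormedAddCommGroup H] [InnerProductSpace ℝ H] [CompleteSpace H]

theorem exp_neg_le_one {t s : ℝ} (ht : 0 ≤ t) (hs : 0 ≤ s) : Real.exp (-(t * s)) ≤ 1 := by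
  rw [Real.exp_le_one_iff, neg_nonpos]
  positivity

theorem bddOn_exp (t : NNReal) : BddOn fun s => Real.exp (-(t * s)) :=
  .of_continuousOn (by fun_prop) (C := 1) fun s hs => by
    rw [abs_of_pos (Real.exp_pos _)]
    exact exp_neg_le_one t.2 hs

/-- The continuous extension of `s ↦ (1 - exp (-ts)) / (ts)`. -/
def expQuotient (t s : ℝ) : ℝ := if s = 0 then 1 else (1 - Real.exp (-(t * s))) / (t * s)

theorem expQuotient_mem_Icc {t s : ℝ} (ht : 0 < t) (hs : 0 ≤ s) :
    expQuotient t s ∈ Icc (0 : ℝ) 1 := by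
  unfold expQuotient
  split_ifs with h
  · simp
  · have hs' : 0 < t * s := mul_pos ht (lt_of_le_of_ne hs (Ne.symm h))
    refine ⟨div_nonneg (by linarith [exp_neg_le_one ht.le hs]) hs'.le, ?_⟩
    rw [div_le_one hs']
    linarith [Real.add_one_le_exp (-(t * s))]

theorem bddOn_expQuotient {t : ℝ} (ht : 0 < t) : BddOn (expQuotient t) := by
  refine ⟨Measurable.indicator ?_ measurableSet_Ici, 1, fun s => ?_⟩
  · exact Measurable.ite (measurableSet_singleton 0) measurable_const (by fun_prop)
  · by_cases hs : 0 ≤ s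
    · have := expQuotient_mem_Icc ht hs
      simpa [indicator, hs, abs_of_nonneg this.1] using this.2
    · simp [indicator, hs]

theorem expQuotient_mul {t : ℝ} (ht : 0 < t) (s : ℝ) :
    expQuotient t s * s = t⁻¹ * (1 - Real.exp (-(t * s))) := by
  unfold expQuotient
  split_ifs with h
  · simp [h]
  · field_simp

theorem tendsto_expQuotient (s : ℝ) :
    Tendsto (fun t : NNReal => expQuotient t s) (𝓝[>] 0) (𝓝 1) := by
  unfold expQuotient
  split_ifs with h
  · exact tendsto_const_nhds
  · have h1 := hasDerivAt_iff_tendsto_slope_zero.mp (Real.hasDerivAt_exp 0)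
    have h2 : Tendsto (fun t : NNReal => -((t : ℝ) * s)) (𝓝[>] 0) (𝓝[≠] 0) := by
      rw [tendsto_nhdsWithin_iff]
      constructor
      · have : Continuous fun t : NNReal => -((t : ℝ) * s) := by fun_prop
        simpa using (this.tendsto 0).mono_left nhdsWithin_le_nhds
      · filter_upwards [self_mem_nhdsWithin] with t ht
        have : (0 : NNReal) < t := ht
        simp [h, this.ne']
    have h3 := h1.comp h2
    rw [Real.exp_zero] at h3
    refine h3.congr fun t => ?_
    simp only [Function.comp_apply, zero_add, smul_eq_mul]
    rw [inv_mul_eq_div, ← neg_sub 1, neg_div_neg_eq]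

namespace SpectralFamily

variable (E : SpectralFamily H)

/-- The semigroup `∫ exp (-ts) dE_s`. -/
def semigroup (t : NNReal) : H →L[ℝ] H := E.op fun s => Real.exp (-(t * s))

theorem norm_op_le {ψ : ℝ → ℝ} (hψ : BddOn ψ) {C : ℝ} (hC : ∀ s, 0 ≤ s → |ψ s| ≤ C) (f : H) :
    ‖E.op ψ f‖ ≤ C * ‖f‖ := by
  have h0 : 0 ≤ C := (abs_nonneg _).trans (hC 0 le_rfl)
  refine (sq_le_sq₀ (norm_nonneg _) (by positivity)).mp ?_
  rw [E.op_norm_sq hψ, mul_pow, ← E.measure_real_univ]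
  refine (le_abs_self _).trans
    (norm_integral_le_of_norm_le_const (f := fun s => ψ s ^ 2) (C := C ^ 2) ?_)
  filter_upwards [E.ae_nonneg f] with s hs
  rw [norm_pow, Real.norm_eq_abs]
  exact pow_le_pow_left₀ (abs_nonneg _) (hC s hs) 2

theorem isContractionSemigroup : IsContractionSemigroup E.semigroup where
  zero := by
    rw [semigroup, ← E.op_one]
    simp
  add s t := by
    rw [semigroup, semigroup, semigroup, ← E.op_mul (bddOn_exp s) (bddOn_exp t)]
    congr 1
    ext x
    rw [← Real.exp_add]
    push_cast
    congr 1
    ring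
  strongly_continuous f := by
    have := E.tendsto_op (l := 𝓝[>] (0 : NNReal)) (Ψ := fun t s => Real.exp (-(t * s)))
      (ψ := fun _ => 1) (C := 1) (Eventually.of_forall bddOn_exp) (.const 1)
      (Eventually.of_forall fun t s hs => by
        rw [abs_of_pos (Real.exp_pos _)]
        exact exp_neg_le_one t.2 hs)
      (fun s _ => by
        have : Continuous fun t : NNReal => Real.exp (-(t * s)) := by fun_prop
        simpa using (this.tendsto 0).mono_left nhdsWithin_le_nhds) f
    rwa [E.op_one] at this
  norm_le t f := by
    have := E.norm_op_le (bddOn_exp t) (C := 1) (fun s hs => by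
        rw [abs_of_pos (Real.exp_pos _)]
        exact exp_neg_le_one t.2 hs) f
    rwa [one_mul] at this

theorem continuousOn_id_Ici : ContinuousOn (fun s : ℝ => s) (Ici 0) := continuousOn_id

/-- The symbol `(exp (-ts) - 1) / t` factors as `-s` times `expQuotient t s`. Below the level `n`
both factors are bounded, and only the second depends on `t`; it tends boundedly to `1`. -/
theorem proj_difference_quotient {t : NNReal} (ht : 0 < t) (n : ℕ) (f : H) :
    E.proj n ((t : ℝ)⁻¹ • (E.semigroup t f - f)) =
      -E.op (expQuotient t) (E.op ((Iic (n : ℝ)).indicator fun s => s) f) := by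
  have ht' : (0 : ℝ) < t := ht
  have h1 : (t : ℝ)⁻¹ • (E.semigroup t f - f) =
      E.op (fun s => (t : ℝ)⁻¹ * (Real.exp (-(t * s)) - 1)) f := by
    rw [E.op_const_mul _ ((bddOn_exp t).sub (.const 1)), E.op_sub (bddOn_exp t) (.const 1),
      E.op_one]
    rfl
  rw [h1, E.proj_op (((bddOn_exp t).sub (.const 1)).const_mul _),
    ← E.op_mul_apply (bddOn_expQuotient ht') (BddOn.cut continuousOn_id_Ici n),
    eq_neg_iff_add_eq_zero, ← add_apply, ← E.op_add]
  · have : E.op (fun _ => 0) = 0 := by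
      have := E.op_const_mul 0 (.const 0)
      simpa using this
    refine Eq.trans ?_ (DFunLike.congr_fun this f)
    congr 2
    ext s
    by_cases hs : s ≤ n
    · simp only [mem_Iic, hs, indicator_of_mem, expQuotient_mul ht']
      ring
    · simp [hs]
  · exact (((bddOn_exp t).sub (.const 1)).const_mul _).indicator measurableSet_Iic
  · exact (bddOn_expQuotient ht').mul (BddOn.cut continuousOn_id_Ici n)

theorem tendsto_op_expQuotient (u : H) :
    Tendsto (fun t : NNReal => E.op (expQuotient t) u) (𝓝[>] 0) (𝓝 u) := by
  have := E.tendsto_op (l := 𝓝[>] (0 : NNReal)) (Ψ := fun t s => expQuotient t s)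
    (ψ := fun _ => 1) (C := 1) ?_ (.const 1) ?_ (fun s _ => tendsto_expQuotient s) u
  · rwa [E.op_one] at this
  · filter_upwards [self_mem_nhdsWithin] with t ht
    exact bddOn_expQuotient (t := (t : ℝ)) ht
  · filter_upwards [self_mem_nhdsWithin] with t ht s hs
    have := expQuotient_mem_Icc (t := (t : ℝ)) ht hs
    rw [abs_of_nonneg this.1]
    exact this.2

/-- If the quotients converge, applying `E_n` identifies the limit at every level. Conversely, if
`-a` is the integral, the quotient is exactly `-expQuotient t` acting on `-a`, which converges with
no truncation left. -/
theorem isGeneratorValue_semigroup_iff (f a : H) :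
    IsGeneratorValue E.semigroup f a ↔ E.IsIntegral (fun s => s) f (-a) := by
  rw [E.isIntegral_iff continuousOn_id_Ici]
  constructor
  · intro h n
    have h1 : Tendsto (fun t : NNReal => E.proj n ((t : ℝ)⁻¹ • (E.semigroup t f - f))) (𝓝[>] 0)
        (𝓝 (E.proj n a)) := ((E.proj n).continuous.tendsto a).comp h
    have h2 := (E.tendsto_op_expQuotient (E.op ((Iic (n : ℝ)).indicator fun s => s) f)).neg
    have h3 := tendsto_nhds_unique h1 (h2.congr' ?_)
    · rw [map_neg, h3, neg_neg]
    · filter_upwards [self_mem_nhdsWithin] with t ht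
      rw [E.proj_difference_quotient ht]
  · intro h
    have h1 := (E.tendsto_op_expQuotient (-a)).neg
    rw [neg_neg] at h1
    refine h1.congr' ?_
    filter_upwards [self_mem_nhdsWithin] with t ht
    refine E.eq_of_forall_proj_eq fun n => ?_
    have hb := bddOn_expQuotient (t := (t : ℝ)) ht
    rw [E.proj_difference_quotient ht, map_neg, ← h, E.proj_op hb, E.op_proj hb]

theorem IsIntegral.op {ψ χ : ℝ → ℝ} (hψ : ContinuousOn ψ (Ici 0)) (hχ : BddOn χ) {f u : H}
    (h : E.IsIntegral ψ f u) : E.IsIntegral ψ (E.op χ f) (E.op χ u) := by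
  rw [E.isIntegral_iff hψ] at h ⊢
  intro n
  rw [E.op_comm (BddOn.cut hψ n) hχ, ← h, E.proj_op hχ, E.op_proj hχ]

theorem isIntegral_proj {ψ : ℝ → ℝ} (hψ : ContinuousOn ψ (Ici 0)) (n : ℕ) (f : H) :
    E.IsIntegral ψ (E.proj n f) (E.op ((Iic (n : ℝ)).indicator ψ) f) := by
  rw [E.isIntegral_iff hψ]
  intro m
  rw [E.op_proj (BddOn.cut hψ m), E.proj_op (BddOn.cut hψ n), indicator_indicator,
    indicator_indicator, inter_comm]

/-- The semigroup of `E` commutes with `∫ s dE_s`, so its orbits stay in the common generator domain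
and `eq_of_generator` applies there. The vectors `E_n f` extend the equality by density. -/
theorem eq_semigroup {P : NNReal → H →L[ℝ] H} (hP : IsContractionSemigroup P)
    (hE : IsSpectralFamilyOfNegGenerator P E) (t : NNReal) : P t = E.semigroup t := by
  have key : ∀ f u, E.IsIntegral (fun s => s) f u → E.semigroup t f = P t f := by
    intro f u h
    refine hP.eq_of_generator E.isContractionSemigroup f (fun r => ?_) t
    have h1 : E.IsIntegral (fun s => s) (E.semigroup r f) (- -E.semigroup r u) := by
      rw [neg_neg]
      exact IsIntegral.op E continuousOn_id_Ici (bddOn_exp r) h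
    exact ⟨-E.semigroup r u, (hE _ _).mpr h1, (E.isGeneratorValue_semigroup_iff _ _).mpr h1⟩
  ext f
  have h1 := ((P t).continuous.tendsto f).comp (E.tendsto_proj_nat f)
  have h2 := ((E.semigroup t).continuous.tendsto f).comp (E.tendsto_proj_nat f)
  refine tendsto_nhds_unique h1 (h2.congr fun n => ?_)
  exact key _ _ (E.isIntegral_proj continuousOn_id_Ici n f)

end SpectralFamily

end

/-! ### The regularised equation and its variational form. -/

theorem exists_lower_bound {φ : ℝ → ℝ} (h0 : ∀ x, 0 ≤ x → 0 ≤ φ x)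
    (hlim : 0 < liminf (fun x : ℝ => (φ x : EReal)) atTop) {t γ : ℝ} (ht : 0 < t) (hγ : 0 < γ)
    (hγ' : γ < 1) :
    ∃ c, 0 < c ∧ ∀ s, 0 ≤ s → c ≤ γ * φ s + (1 - γ) * Real.exp (-(s * t)) := by
  obtain ⟨b, hb0, hb⟩ := EReal.lt_iff_exists_real_btwn.mp hlim
  obtain ⟨R, hR⟩ := eventually_atTop.mp (eventually_lt_of_lt_liminf hb)
  have hb0' : 0 < b := by exact_mod_cast hb0
  refine ⟨min (γ * b) ((1 - γ) * Real.exp (-(max R 0 * t))), ?_, fun s hs => ?_⟩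
  · exact lt_min (by positivity) (mul_pos (by linarith) (Real.exp_pos _))
  · rcases le_total R s with h | h
    · have h1 : b < φ s := by exact_mod_cast hR s h
      refine (min_le_left _ _).trans ?_
      have := mul_le_mul_of_nonneg_left h1.le hγ.le
      have h2 : 0 ≤ (1 - γ) * Real.exp (-(s * t)) :=
        mul_nonneg (by linarith) (Real.exp_pos _).le
      linarith
    · refine (min_le_right _ _).trans ?_
      have h1 : Real.exp (-(max R 0 * t)) ≤ Real.exp (-(s * t)) := by
        gcongr
        exact h.trans (le_max_left _ _)
      have := mul_le_mul_of_nonneg_left h1 (by linarith : 0 ≤ 1 - γ)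
      have h2 := mul_nonneg hγ.le (h0 s hs)
      linarith

theorem bddOn_exp_mul {φ : ℝ → ℝ} {t : NNReal} (hφ : ContinuousOn φ (Ici 0))
    (h0 : ∀ x, 0 ≤ x → 0 ≤ φ x)
    (hbdd : BddAbove ((fun x : ℝ => Real.exp (-(t * x)) * φ x) '' Ici 0)) :
    BddOn fun s => Real.exp (-(t * s)) * φ s := by
  obtain ⟨C, hC⟩ := hbdd
  refine .of_continuousOn (by fun_prop) (C := C) fun s hs => ?_
  rw [abs_of_nonneg (mul_nonneg (Real.exp_pos _).le (h0 s hs))]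
  exact hC ⟨s, hs, rfl⟩

section

variable {H : Type*} [NormedAddCommGroup H] [InnerProductSpace ℝ H]

/-- The expansion at `h₀` is exact: at a critical point the increment along `k` is `‖P t k‖² + γ /
(1 - γ) (B k, k)`, which is positive for `k ≠ 0` by injectivity of `P t`. -/
theorem functional_lt_of_critical (P : NNReal → H →L[ℝ] H) (B : H →L[ℝ] H) {t : NNReal}
    {γ : ℝ} (hγ : 0 < γ) (hγ' : γ < 1) {g h₀ : H}
    (hsymm : ∀ f h, inner ℝ (B f) h = inner ℝ f (B h)) (hnonneg : ∀ k, 0 ≤ inner ℝ (B k) k)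
    (hinj : ∀ k, P t k = 0 → k = 0)
    (hcrit : ∀ k, inner ℝ (P t h₀ - g) (P t k) + γ / (1 - γ) * inner ℝ (B h₀) k = 0)
    {h : H} (hne : h ≠ h₀) : functional P B t γ g h₀ < functional P B t γ g h := by
  obtain ⟨k, rfl⟩ : ∃ k, h = h₀ + k := ⟨h - h₀, by abel⟩
  have hk : 0 < ‖P t k‖ := norm_pos_iff.mpr fun h0 => hne (by simp [hinj k h0])
  have h1 : ‖P t (h₀ + k) - g‖ ^ 2 =
      ‖P t h₀ - g‖ ^ 2 + 2 * inner ℝ (P t h₀ - g) (P t k) + ‖P t k‖ ^ 2 := by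
    rw [map_add, add_sub_right_comm, norm_add_sq_real]
  have h2 : inner ℝ (B (h₀ + k)) (h₀ + k) =
      inner ℝ (B h₀) h₀ + 2 * inner ℝ (B h₀) k + inner ℝ (B k) k := by
    rw [map_add, inner_add_left, inner_add_right, inner_add_right, hsymm k h₀,
      real_inner_comm (B h₀) k]
    ring
  have h3 : 0 < γ / (1 - γ) := div_pos hγ (by linarith)
  unfold functional
  rw [h1, h2]
  have := hcrit k
  have h4 := mul_nonneg h3.le (hnonneg k)
  have h5 : 0 < ‖P t k‖ ^ 2 := by positivity
  linarith

end

section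

variable {H : Type*} [NormedAddCommGroup H] [InnerProductSpace ℝ H] [CompleteSpace H]

namespace SpectralFamily

variable (E : SpectralFamily H)

/-- Below the level `n` the symbol `exp (ts)` is bounded and inverts the semigroup, so every `E_n k`
vanishes. -/
theorem semigroup_injective (t : NNReal) {k : H} (hk : E.semigroup t k = 0) : k = 0 := by
  refine E.eq_of_forall_proj_eq fun n => ?_
  have hc : ContinuousOn (fun s : ℝ => Real.exp (t * s)) (Ici 0) := by fun_prop
  have h1 := E.op_mul_apply (BddOn.cut hc n) (bddOn_exp t) k
  rw [← semigroup, hk, map_zero] at h1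
  rw [map_zero, ← h1, ← E.op_indicator_Iic]
  congr 2
  ext s
  by_cases hs : s ≤ n
  · simp [indicator, hs, ← Real.exp_add]
  · simp [indicator, hs]

variable {φ : ℝ → ℝ} {t : NNReal}

theorem op_exp_mul_of_isIntegral (hφ : ContinuousOn φ (Ici 0))
    (hb : BddOn fun s => Real.exp (-(t * s)) * φ s) {h u : H} (hu : E.IsIntegral φ h u) :
    E.op (fun s => Real.exp (-(t * s)) * φ s) h = E.semigroup t u := by
  rw [E.isIntegral_iff hφ] at hu
  refine E.eq_of_forall_proj_eq fun n => ?_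
  rw [semigroup, E.proj_op (bddOn_exp t), ← E.op_proj (bddOn_exp t), hu, E.proj_op hb,
    ← E.op_mul_apply (bddOn_exp t) (BddOn.cut hφ n)]
  exact DFunLike.congr_fun (congrArg E.op (funext fun s => indicator_mul_right _ _ _)) h

theorem isSemigroupComp_op {P : NNReal → H →L[ℝ] H} (hP : P t = E.semigroup t)
    (hφ : ContinuousOn φ (Ici 0)) (hb : BddOn fun s => Real.exp (-(t * s)) * φ s) :
    IsSemigroupComp P E φ t (E.op fun s => Real.exp (-(t * s)) * φ s) :=
  ⟨E.isIntegral_op (by fun_prop) hb, fun h u hu => by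
    rw [hP, E.op_exp_mul_of_isIntegral hφ hb hu]⟩

theorem exists_unique_regularisedSolution {P : NNReal → H →L[ℝ] H} (hP : P t = E.semigroup t)
    (ht : 0 < t) (hφ : ContinuousOn φ (Ici 0)) (h0 : ∀ x, 0 ≤ x → 0 ≤ φ x)
    (hlim : 0 < liminf (fun x : ℝ => (φ x : EReal)) atTop)
    (hb : BddOn fun s => Real.exp (-(t * s)) * φ s) {γ : ℝ} (hγ : 0 < γ) (hγ' : γ < 1) (g : H) :
    ∃ f, IsRegularisedSolution P E φ t γ g f ∧
      (∀ f', IsRegularisedSolution P E φ t γ g f' → f' = f) ∧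
      E.IsIntegral (fun s => 1 / (γ * φ s + (1 - γ) * Real.exp (-(s * t)))) g f ∧
      ∀ h, h ≠ (1 - γ) • f →
        functional P (E.op fun s => Real.exp (-(t * s)) * φ s) t γ g ((1 - γ) • f) <
          functional P (E.op fun s => Real.exp (-(t * s)) * φ s) t γ g h := by
  obtain ⟨c, hc0, hc⟩ := exists_lower_bound h0 hlim (t := t) ht hγ hγ'
  set q : ℝ → ℝ := fun s => γ * φ s + (1 - γ) * Real.exp (-(s * t)) with hq
  have hqpos : ∀ s, 0 ≤ s → 0 < q s := fun s hs => hc0.trans_le (hc s hs)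
  have hqc : ContinuousOn q (Ici 0) := by fun_prop
  have hrc : ContinuousOn (fun s => 1 / q s) (Ici 0) :=
    continuousOn_const.div hqc fun s hs => (hqpos s hs).ne'
  have hr : BddOn fun s => 1 / q s := .of_continuousOn hrc (C := 1 / c) fun s hs => by
    rw [abs_of_pos (by have := hqpos s hs; positivity)]
    exact one_div_le_one_div_of_le hc0 (hc s hs)
  have hφr : BddOn fun s => φ s * (1 / q s) :=
    -- The bound is `γ φ ≤ q`; no growth restriction on `φ` enters here.
    .of_continuousOn (hφ.mul hrc) (C := 1 / γ) fun s hs => by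
      have h1 := hqpos s hs
      rw [abs_of_nonneg (mul_nonneg (h0 s hs) (by positivity)), mul_one_div,
        div_le_div_iff₀ h1 hγ, one_mul]
      have : 0 ≤ (1 - γ) * Real.exp (-(s * t)) := mul_nonneg (by linarith) (Real.exp_pos _).le
      simp only [hq]
      linarith
  set f := E.op (fun s => 1 / q s) g with hf
  set u := E.op (fun s => φ s * (1 / q s)) g with hu
  have hint : E.IsIntegral φ f u := by
    rw [E.isIntegral_iff hφ]
    intro n
    rw [hu, E.proj_op hφr, hf, ← E.op_mul_apply (BddOn.cut hφ n) hr]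
    exact DFunLike.congr_fun (congrArg E.op (funext fun s => indicator_mul_left _ _ _)) g
  have heq : (1 - γ) • P t f + γ • u = g := by
    have he := (bddOn_exp t).mul hr
    rw [hP, hf, hu, semigroup, ← E.op_mul_apply (bddOn_exp t) hr, ← smul_apply,
      ← smul_apply, ← E.op_const_mul _ he, ← E.op_const_mul _ hφr, ← add_apply,
      ← E.op_add (he.const_mul _) (hφr.const_mul _)]
    refine Eq.trans ?_ (DFunLike.congr_fun E.op_one g)
    refine DFunLike.congr_fun (E.op_congr fun s hs => ?_) g
    have h1 := (hqpos s hs).ne'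
    have h2 : q s = γ * φ s + (1 - γ) * Real.exp (-(t * s)) := by simp only [hq, mul_comm s]
    field_simp
    rw [h2]
    ring
  refine ⟨f, ⟨u, hint, heq⟩, ?_, E.isIntegral_op hrc hr g, fun h hne => ?_⟩
  · rintro f' ⟨u', hint', heq'⟩
    rw [E.isIntegral_iff hφ] at hint'
    refine E.eq_of_forall_proj_eq fun n => ?_
    have he : BddOn ((Iic (n : ℝ)).indicator fun s => Real.exp (-(t * s))) :=
      (bddOn_exp t).indicator measurableSet_Iic
    have hcut := BddOn.cut hφ n
    -- Truncated at `n`, any solution satisfies `q f' = g` with a bounded symbol, so multiplying by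
    -- `1 / q` recovers `E_n f'` from `g`.
    have h1 : E.proj n g = E.op ((Iic (n : ℝ)).indicator q) f' := by
      rw [← heq', map_add, map_smul, map_smul, hint', hP, semigroup, E.proj_op (bddOn_exp t),
        ← smul_apply, ← smul_apply, ← E.op_const_mul _ he, ← E.op_const_mul _ hcut, ← add_apply,
        ← E.op_add (he.const_mul _) (hcut.const_mul _)]
      congr 2
      ext s
      by_cases hs : s ≤ n
      · simp only [mem_Iic, hs, indicator_of_mem, hq]
        rw [mul_comm s, add_comm]
      · simp [hs]
    rw [hf, E.proj_op hr, ← E.op_proj hr, h1, ← E.op_mul_apply hr (BddOn.cut hqc n),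
      ← E.op_indicator_Iic]
    refine DFunLike.congr_fun (E.op_congr fun s hs => ?_) f'
    have h1 := (hqpos s hs).ne'
    by_cases hs : s ≤ n <;> simp [indicator, hs, h1]
  · refine functional_lt_of_critical P _ hγ hγ' (E.op_symm hb) (fun k => ?_) (fun k hk => ?_)
      (fun k => ?_) hne
    · rw [E.op_quad hb, ← E.integral_indicator_Ici]
      exact integral_nonneg fun s =>
        indicator_nonneg (fun s hs => mul_nonneg (Real.exp_pos _).le (h0 s hs)) s
    · exact E.semigroup_injective t (hP ▸ hk)
    · have hPs : ∀ a b, inner ℝ a (P t b) = inner ℝ (P t a) b := fun a b => by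
        rw [hP, semigroup, E.op_symm (bddOn_exp t)]
      rw [hPs, map_smul (E.op fun s => Real.exp (-(t * s)) * φ s),
        E.op_exp_mul_of_isIntegral hφ hb hint, ← hP, map_smul (P t)]
      -- At `(1 - γ) f` the residual term contributes `-γ (P t u, k)`. The penalty contributes `γ (P
      -- t u, k)`, because `P t φ(-A)` sends `(1 - γ) f` to `(1 - γ) P t u`.
      have h1 : (1 - γ) • P t f - g = -(γ • u) := by rw [← heq]; abel
      rw [h1, map_neg, map_smul, inner_neg_left, real_inner_smul_left, real_inner_smul_left]
      have h2 : 1 - γ ≠ 0 := by linarith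
      field_simp
      ring

end SpectralFamily

end

/-! ### Representing measures on the unit interval. -/

open unitInterval

section

variable {H : Type*} [NormedAddCommGroup H] [InnerProductSpace ℝ H]

/-- Compress `T` to the Krylov space spanned by `f, T f, …, T^d f`. The compression `S` is
symmetric, satisfies `S^k f = T^k f` for `k ≤ d`, and is diagonalisable. The nodes are its
eigenvalues, which lie in `[0, 1]` by the form bounds; the weights are the squared coefficients of
`f` in the eigenbasis. -/
theorem exists_quadrature (T : H →L[ℝ] H) (hsymm : ∀ f h, inner ℝ (T f) h = inner ℝ f (T h))
    (h0 : ∀ f, 0 ≤ inner ℝ (T f) f) (h1 : ∀ f, inner ℝ (T f) f ≤ ‖f‖ ^ 2) (f : H) (d : ℕ) :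
    ∃ (n : ℕ) (w lam : Fin n → ℝ), (∀ i, 0 ≤ w i) ∧ (∀ i, lam i ∈ Icc (0 : ℝ) 1) ∧
      ∀ k ≤ d, ∑ i, w i * lam i ^ k = inner ℝ ((T ^ k) f) f := by
  let K : Submodule ℝ H := Submodule.span ℝ (range fun j : Fin (d + 1) => (T ^ (j : ℕ)) f)
  have hmem : ∀ k ≤ d, (T ^ k) f ∈ K := fun k hk =>
    Submodule.subset_span ⟨⟨k, Nat.lt_succ_of_le hk⟩, rfl⟩
  have hfin : FiniteDimensional ℝ K := FiniteDimensional.span_of_finite ℝ (finite_range _)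
  let S : K →ₗ[ℝ] K := (K.orthogonalProjectionOnto ∘L T ∘L K.subtypeL : K →L[ℝ] K)
  have hS : ∀ x y : K, inner ℝ (S x) y = inner ℝ (T x) (y : H) := fun x y =>
    Submodule.inner_orthogonalProjectionOnto_eq_of_mem_right y (T x)
  have hSs : S.IsSymmetric := fun x y => by
    rw [hS, hsymm, ← real_inner_comm, ← hS, real_inner_comm]
  let f₀ : K := ⟨f, by simpa using hmem 0 (Nat.zero_le d)⟩
  have hpow : ∀ k ≤ d, (((S ^ k) f₀ : K) : H) = (T ^ k) f := by
    intro k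
    induction k with
    | zero => simp [f₀]
    | succ k ih =>
      intro hk
      have e1 := ih (by omega)
      rw [pow_succ', pow_succ', Module.End.mul_apply, mul_apply_eq_comp, ← e1]
      have e2 : T ((S ^ k) f₀ : K) ∈ K := by
        rw [e1, ← mul_apply_eq_comp, ← pow_succ']
        exact hmem _ hk
      exact congrArg Subtype.val (Submodule.orthogonalProjectionOnto_mem_subspace_eq_self ⟨_, e2⟩)
  let b := hSs.eigenvectorBasis rfl
  let lam := hSs.eigenvalues rfl
  have hb : ∀ i, S (b i) = lam i • b i := fun i => hSs.apply_eigenvectorBasis rfl i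
  have hlam : ∀ i, lam i = inner ℝ (T (b i)) (b i : H) := fun i => by
    rw [← hS, hb, real_inner_smul_left, real_inner_self_eq_norm_sq, b.norm_eq_one]
    simp
  refine ⟨_, fun i => inner ℝ (b i) f₀ ^ 2, lam, fun i => sq_nonneg _, fun i => ?_, fun k hk => ?_⟩
  · rw [hlam]
    refine ⟨h0 _, (h1 _).trans ?_⟩
    have hbi : ‖(b i : H)‖ = 1 := b.norm_eq_one i
    rw [hbi, one_pow]
  · have hcoef : ∀ i, inner ℝ (b i) ((S ^ k) f₀) = lam i ^ k * inner ℝ (b i) f₀ := by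
      intro i
      clear hk
      induction k with
      | zero => simp
      | succ k ih =>
        rw [pow_succ', Module.End.mul_apply, ← hSs, hb, real_inner_smul_left, ih]
        ring
    rw [← hpow k hk]
    change _ = inner ℝ ((S ^ k) f₀) f₀
    rw [← b.sum_inner_mul_inner]
    refine Finset.sum_congr rfl fun i _ => ?_
    rw [real_inner_comm, hcoef]
    ring

variable {P : NNReal → H →L[ℝ] H}

theorem IsContractionSemigroup.map_nsmul (hP : IsContractionSemigroup P) (k : ℕ) (t : NNReal) :
    P (k * t) = P t ^ k := by
  induction k with
  | zero =>
    rw [Nat.cast_zero, zero_mul, pow_zero, hP.zero]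
    rfl
  | succ k ih =>
    rw [pow_succ, ← ih, Nat.cast_succ, add_mul, one_mul, hP.add]
    rfl

theorem IsContractionSemigroup.inner_self (hP : IsContractionSemigroup P)
    (hsymm : ∀ t f g, inner ℝ (P t f) g = inner ℝ f (P t g)) (t : NNReal) (f : H) :
    inner ℝ (P t f) f = ‖P (t / 2) f‖ ^ 2 := by
  rw [← real_inner_self_eq_norm_sq, ← hsymm, ← ContinuousLinearMap.comp_apply, ← hP.add,
    add_halves]

/-- Quadrature is applied to `P (1 / 2 ^ n)` and the nodes are raised to the power `2 ^ n`, so that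
`x ^ (j / 2 ^ n)` is the `j`-th power of the original node. The degree `2 ^ n * 2 ^ n` covers the
times up to `2 ^ n` in steps of `1 / 2 ^ n`, so every dyadic time is eventually reached. -/
theorem exists_dyadic_measure (hP : IsContractionSemigroup P)
    (hsymm : ∀ t f g, inner ℝ (P t f) g = inner ℝ f (P t g)) {f : H} (hf : ‖f‖ = 1) (n : ℕ) :
    ∃ ρ : ProbabilityMeasure I, ∀ j : ℕ, j ≤ 2 ^ n * 2 ^ n →
      ∫ x : I, (x : ℝ) ^ ((j : ℝ) / 2 ^ n) ∂(ρ : Measure I) =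
        inner ℝ (P (j / 2 ^ n) f) f := by
  obtain ⟨N, w, lam, hw, hlam, hsum⟩ := exists_quadrature (P (1 / 2 ^ n)) (hsymm _)
    (fun f => by rw [hP.inner_self hsymm]; positivity)
    (fun f => by
      rw [hP.inner_self hsymm]
      exact pow_le_pow_left₀ (norm_nonneg _) (hP.norm_le _ _) 2) f (2 ^ n * 2 ^ n)
  let y : Fin N → I := fun i => ⟨lam i ^ 2 ^ n, pow_nonneg (hlam i).1 _,
    pow_le_one₀ (hlam i).1 (hlam i).2⟩
  let ρ : Measure I := ∑ i, ENNReal.ofReal (w i) • Measure.dirac (y i)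
  have hw1 : ∑ i, w i = 1 := by
    have := hsum 0 (Nat.zero_le _)
    simpa [hf] using this
  have hρ : IsProbabilityMeasure ρ := by
    constructor
    simp only [ρ, Measure.coe_finsetSum, Finset.sum_apply, Measure.smul_apply, measure_univ,
      smul_eq_mul, mul_one]
    rw [← ENNReal.ofReal_sum_of_nonneg fun i _ => hw i, hw1, ENNReal.ofReal_one]
  refine ⟨⟨ρ, hρ⟩, fun j hj => ?_⟩
  change ∫ x : I, (x : ℝ) ^ ((j : ℝ) / 2 ^ n) ∂ρ = _
  have hmeas : Measurable fun x : I => (x : ℝ) ^ ((j : ℝ) / 2 ^ n) := by fun_prop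
  have hint : ∀ i, Integrable (fun x : I => (x : ℝ) ^ ((j : ℝ) / 2 ^ n))
      (ENNReal.ofReal (w i) • Measure.dirac (y i)) := fun i => by
    have : IsBddMeas fun x : I => (x : ℝ) ^ ((j : ℝ) / 2 ^ n) := ⟨hmeas, 1, fun x => by
      rw [abs_of_nonneg (Real.rpow_nonneg x.2.1 _)]
      exact Real.rpow_le_one x.2.1 x.2.2 (by positivity)⟩
    exact (this.integrable _).smul_measure ENNReal.ofReal_ne_top
  rw [integral_finsetSum_measure fun i _ => hint i]
  have e1 : (j / 2 ^ n : NNReal) = j * (1 / 2 ^ n) := by ring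
  rw [e1, hP.map_nsmul, ← hsum j hj]
  refine Finset.sum_congr rfl fun i _ => ?_
  rw [integral_smul_measure, integral_dirac, ENNReal.toReal_ofReal (hw i), smul_eq_mul]
  congr 1
  change (lam i ^ 2 ^ n) ^ ((j : ℝ) / 2 ^ n) = _
  rw [← Real.rpow_natCast, ← Real.rpow_mul (hlam i).1]
  push_cast
  rw [mul_div_cancel₀ _ (by positivity), Real.rpow_natCast]

theorem isBddMeas_rpow {t : ℝ} (ht : 0 ≤ t) : IsBddMeas fun x : I => (x : ℝ) ^ t :=
  ⟨by fun_prop, 1, fun x => by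
    rw [abs_of_nonneg (Real.rpow_nonneg x.2.1 _)]
    exact Real.rpow_le_one x.2.1 x.2.2 ht⟩

/-- Probability measures on `[0, 1]` are weakly compact, and a limit along an ultrafilter keeps
every dyadic moment, since each is eventually constant in `n`. Continuity in `t` then reaches all
positive times. -/
theorem exists_probability_representation (hP : IsContractionSemigroup P)
    (hsymm : ∀ t f g, inner ℝ (P t f) g = inner ℝ f (P t g)) {f : H} (hf : ‖f‖ = 1) :
    ∃ ν : Measure I, IsProbabilityMeasure ν ∧
      ∀ t : NNReal, 0 < t → ∫ x : I, (x : ℝ) ^ (t : ℝ) ∂ν = inner ℝ (P t f) f := by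
  choose ρ hρ using exists_dyadic_measure hP hsymm hf
  obtain ⟨ν, -, hν⟩ := isCompact_univ.ultrafilter_le_nhds ((hyperfilter ℕ).map ρ) (by simp)
  have hν' : Tendsto ρ (hyperfilter ℕ : Filter ℕ) (𝓝 ν) := hν
  have hdyadic : ∀ j m : ℕ, 0 < j → ∫ x : I, (x : ℝ) ^ ((j : ℝ) / 2 ^ m) ∂(ν : Measure I) =
      inner ℝ (P (j / 2 ^ m) f) f := by
    intro j m hj
    let g : BoundedContinuousFunction I ℝ := BoundedContinuousFunction.mkOfCompact
      ⟨fun x : I => (x : ℝ) ^ ((j : ℝ) / 2 ^ m),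
        (Real.continuous_rpow_const (by positivity)).comp continuous_subtype_val⟩
    have h1 := (ProbabilityMeasure.tendsto_iff_forall_integral_tendsto.mp hν') g
    refine tendsto_nhds_unique h1 (tendsto_const_nhds.congr' ?_)
    have : ∀ᶠ n in atTop, inner ℝ (P (j / 2 ^ m) f) f = ∫ x, g x ∂(ρ n : Measure I) := by
      filter_upwards [eventually_ge_atTop m, eventually_ge_atTop j] with n hn hn'
      obtain ⟨k, rfl⟩ := Nat.exists_eq_add_of_le hn
      have h2 := hρ (m + k) (j * 2 ^ k) (by
        have : j ≤ 2 ^ (m + k) := hn'.trans Nat.lt_two_pow_self.le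
        exact Nat.mul_le_mul this (Nat.pow_le_pow_right Nat.two_pos (Nat.le_add_left k m)))
      have e1 : ((j * 2 ^ k : ℕ) : ℝ) / 2 ^ (m + k) = j / 2 ^ m := by
        push_cast
        rw [pow_add]
        field_simp
      have e2 : ((j * 2 ^ k : ℕ) : NNReal) / 2 ^ (m + k) = j / 2 ^ m := by
        push_cast
        rw [pow_add]
        field_simp
      rw [e1, e2] at h2
      exact h2.symm
    exact Nat.hyperfilter_le_atTop this
  refine ⟨ν, inferInstance, fun t ht => ?_⟩
  -- Rounding up keeps the dyadic approximants positive.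
  let q : ℕ → NNReal := fun n => (⌈(t : ℝ) * 2 ^ n⌉₊ : NNReal) / 2 ^ n
  have hq : Tendsto q atTop (𝓝 t) := by
    rw [← NNReal.tendsto_coe]
    have := (tendsto_nat_ceil_mul_div_atTop t.2).comp
      (tendsto_pow_atTop_atTop_of_one_lt (one_lt_two (α := ℝ)))
    simpa [q, Function.comp_def] using this
  have h1 : Tendsto (fun n => inner ℝ (P (q n) f) f) atTop (𝓝 (inner ℝ (P t f) f)) :=
    (((hP.continuous_apply f).tendsto t).comp hq).inner tendsto_const_nhds
  have h2 : Tendsto (fun n => ∫ x : I, (x : ℝ) ^ (q n : ℝ) ∂(ν : Measure I)) atTop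
      (𝓝 (∫ x : I, (x : ℝ) ^ (t : ℝ) ∂(ν : Measure I))) := by
    refine tendsto_integral_of_dominated_convergence (fun _ => 1)
      (fun n => (isBddMeas_rpow (q n).2).measurable.aestronglyMeasurable) (integrable_const _)
      (fun n => ae_of_all _ fun x => ?_) (ae_of_all _ fun x => ?_)
    · rw [Real.norm_eq_abs, abs_of_nonneg (Real.rpow_nonneg x.2.1 _)]
      exact Real.rpow_le_one x.2.1 x.2.2 (q n).2
    · exact (Real.continuousAt_const_rpow' (by positivity)).tendsto.comp
        ((NNReal.continuous_coe.tendsto t).comp hq)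
  refine tendsto_nhds_unique h2 (h1.congr fun n => ?_)
  have h3 := hdyadic ⌈(t : ℝ) * 2 ^ n⌉₊ n (Nat.ceil_pos.mpr (by positivity))
  rw [← h3]
  simp [q]

/-- As `t ↓ 0` the moments tend to the mass of `(0, 1]`, while strong continuity makes `(P t f, f)`
tend to `‖f‖²`, the total mass. Hence `0` carries no mass. The unit-vector case is rescaled by
`‖f‖²`. -/
theorem exists_representation (hP : IsContractionSemigroup P)
    (hsymm : ∀ t f g, inner ℝ (P t f) g = inner ℝ f (P t g)) (f : H) :
    ∃ ν : Measure I, IsFiniteMeasure ν ∧ ν {0} = 0 ∧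
      ∀ t : NNReal, ∫ x : I, (x : ℝ) ^ (t : ℝ) ∂ν = inner ℝ (P t f) f := by
  rcases eq_or_ne f 0 with rfl | hf
  · exact ⟨0, inferInstance, by simp, by simp⟩
  have hf' : ‖f‖ ≠ 0 := norm_ne_zero_iff.mpr hf
  obtain ⟨ν, hν, h⟩ := exists_probability_representation hP hsymm (f := ‖f‖⁻¹ • f)
    (by rw [norm_smul, norm_inv, norm_norm, inv_mul_cancel₀ hf'])
  refine ⟨ENNReal.ofReal (‖f‖ ^ 2) • ν, ?_, ?_, fun t => ?_⟩
  · exact Measure.smul_finite ν ENNReal.ofReal_ne_top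
  · have h1 : Tendsto (fun n : ℕ => ∫ x : I, (x : ℝ) ^ (((1 / (n + 1) : NNReal)) : ℝ) ∂ν) atTop
        (𝓝 (∫ x : I, ({0}ᶜ : Set I).indicator (fun _ => (1 : ℝ)) x ∂ν)) := by
      refine tendsto_integral_of_dominated_convergence (fun _ => 1)
        (fun n => (isBddMeas_rpow (NNReal.coe_nonneg _)).measurable.aestronglyMeasurable)
        (integrable_const _) (fun n => ae_of_all _ fun x => ?_) (ae_of_all _ fun x => ?_)
      · rw [Real.norm_eq_abs, abs_of_nonneg (Real.rpow_nonneg x.2.1 _)]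
        exact Real.rpow_le_one x.2.1 x.2.2 (NNReal.coe_nonneg _)
      · rcases eq_or_ne x 0 with rfl | hx
        · refine tendsto_const_nhds.congr fun n => ?_
          have : ((1 / (n + 1) : NNReal) : ℝ) ≠ 0 := by positivity
          simp only [Icc.coe_zero, Real.zero_rpow this]
          simp
        · have hx' : (x : ℝ) ≠ 0 := fun h => hx (Subtype.ext h)
          have := ((Real.continuousAt_const_rpow (b := 0) hx').tendsto.comp
            (tendsto_one_div_add_atTop_nhds_zero_nat (𝕜 := ℝ)))
          simpa [hx, Function.comp_def] using this
    have h2 : Tendsto (fun n : ℕ => inner ℝ (P (1 / (n + 1)) (‖f‖⁻¹ • f)) (‖f‖⁻¹ • f)) atTop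
        (𝓝 (inner ℝ (‖f‖⁻¹ • f) (‖f‖⁻¹ • f))) := by
      have h3 : Tendsto (fun n : ℕ => (1 / (n + 1) : NNReal)) atTop (𝓝 0) :=
        NNReal.tendsto_coe.mp (by
          simpa using tendsto_one_div_add_atTop_nhds_zero_nat (𝕜 := ℝ))
      exact ((hP.tendsto_zero _).comp h3).inner tendsto_const_nhds
    have h3 := tendsto_nhds_unique h1 (h2.congr fun n => (h _ (by positivity)).symm)
    rw [integral_indicator_const _ (measurableSet_singleton _).compl, smul_eq_mul, mul_one,
      real_inner_self_eq_norm_sq, norm_smul, norm_inv, norm_norm, inv_mul_cancel₀ hf',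
      probReal_compl_eq_one_sub (measurableSet_singleton _)] at h3
    have h4 : ν.real {0} = 0 := by linarith
    rw [measureReal_eq_zero_iff] at h4
    simp [h4]
  · rw [integral_smul_measure, ENNReal.toReal_ofReal (by positivity), smul_eq_mul]
    rcases eq_or_ne t 0 with rfl | ht
    · simp [hP.zero]
    · rw [h t (pos_iff_ne_zero.mpr ht), map_smul, real_inner_smul_left, real_inner_smul_right]
      field_simp

end

/-- Natural exponents already suffice: equality of integrals is a closed condition on `C(I, ℝ)`,
holds for polynomials, and polynomials are dense. -/
theorem determines_rpow : Determines (fun (t : NNReal) (x : I) => (x : ℝ) ^ (t : ℝ)) := by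
  intro ν₁ ν₂ _ _ h
  refine ext_of_forall_integral_eq_of_IsFiniteMeasure fun g => ?_
  have hL : ∀ ν : Measure I, IsFiniteMeasure ν → Continuous fun g : C(I, ℝ) => ∫ x, g x ∂ν := by
    intro ν _
    refine (LipschitzWith.of_dist_le_mul (K := (ν univ).toNNReal) fun g k => ?_).continuous
    have hint : ∀ g : C(I, ℝ), Integrable g ν := fun g =>
      (BoundedContinuousFunction.mkOfCompact g).integrable ν
    rw [dist_eq_norm, ← integral_sub (hint g) (hint k), mul_comm]
    exact norm_integral_le_of_norm_le_const (ae_of_all _ fun x => by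
      rw [← dist_eq_norm]
      exact ContinuousMap.dist_apply_le_dist x)
  have hclosed : IsClosed {g : C(I, ℝ) | ∫ x, g x ∂ν₁ = ∫ x, g x ∂ν₂} :=
    isClosed_eq (hL ν₁ inferInstance) (hL ν₂ inferInstance)
  have hpoly : (polynomialFunctions I : Set C(I, ℝ)) ⊆
      {g : C(I, ℝ) | ∫ x, g x ∂ν₁ = ∫ x, g x ∂ν₂} := by
    rw [polynomialFunctions_coe]
    rintro _ ⟨p, rfl⟩
    have key : ∀ ν : Measure I, IsFiniteMeasure ν →
        ∫ x, Polynomial.toContinuousMapOnAlgHom I p x ∂ν =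
          ∑ k ∈ Finset.range (p.natDegree + 1),
            p.coeff k * ∫ x : I, (x : ℝ) ^ ((k : NNReal) : ℝ) ∂ν := by
      intro ν _
      simp only [Polynomial.toContinuousMapOnAlgHom_apply, Polynomial.toContinuousMapOn_apply,
        Polynomial.toContinuousMap_apply, Polynomial.eval_eq_sum_range]
      rw [integral_finsetSum]
      · simp [integral_const_mul]
      · intro k _
        have := ((isBddMeas_rpow (Nat.cast_nonneg k)).const_mul (p.coeff k)).integrable ν
        simpa using this
    change ∫ x, Polynomial.toContinuousMapOnAlgHom I p x ∂ν₁ =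
      ∫ x, Polynomial.toContinuousMapOnAlgHom I p x ∂ν₂
    rw [key ν₁ inferInstance, key ν₂ inferInstance]
    simp only [h]
  have h1 : (g.toContinuousMap : C(I, ℝ)) ∈ (polynomialFunctions I).topologicalClosure := by
    rw [polynomialFunctions_closure_eq_top']
    trivial
  exact closure_minimal hpoly hclosed h1

/-! ### Construction of the spectral family. -/

section

variable {H : Type*} [NormedAddCommGroup H] [InnerProductSpace ℝ H] [CompleteSpace H]

/-- The part of the unit interval on which `-log x ≤ s`, apart from the point `0`. -/
def expTail (s : ℝ) : Set I := {x | Real.exp (-s) ≤ x}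

theorem measurableSet_expTail (s : ℝ) : MeasurableSet (expTail s) :=
  measurableSet_le measurable_const measurable_subtype_coe

theorem expTail_mono {r s : ℝ} (h : r ≤ s) : expTail r ⊆ expTail s := fun _ hx =>
  (Real.exp_le_exp.mpr (neg_le_neg h)).trans hx

/-- The sets increase with `s`, and non-membership is the strict inequality `x < exp (-s)`, which
persists for `r` slightly above `s`. The non-strict inequality in `expTail` is what gives continuity
from the right. -/
theorem tendsto_indicator_expTail (s : ℝ) (x : I) :
    Tendsto (fun r => (expTail r).indicator (fun _ => (1 : ℝ)) x) (𝓝[≥] s)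
      (𝓝 ((expTail s).indicator (fun _ => (1 : ℝ)) x)) := by
  refine tendsto_const_nhds.congr' ?_
  by_cases hx : x ∈ expTail s
  · filter_upwards [self_mem_nhdsWithin] with r hr
    rw [indicator_of_mem hx, indicator_of_mem (expTail_mono hr hx)]
  · have h1 : (x : ℝ) < Real.exp (-s) := not_le.mp hx
    have h2 : Tendsto (fun r => Real.exp (-r)) (𝓝[≥] s) (𝓝 (Real.exp (-s))) :=
      ((by fun_prop : Continuous fun r : ℝ => Real.exp (-r)).tendsto s).mono_left
        nhdsWithin_le_nhds
    filter_upwards [h2.eventually (lt_mem_nhds h1)] with r hr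
    rw [indicator_of_notMem hx, indicator_of_notMem (show x ∉ expTail r from not_le.mpr hr)]

theorem tendsto_indicator_expTail_atTop {x : I} (hx : x ≠ 0) :
    Tendsto (fun r => (expTail r).indicator (fun _ => (1 : ℝ)) x) atTop (𝓝 1) := by
  refine tendsto_const_nhds.congr' ?_
  have hx' : 0 < (x : ℝ) := unitInterval.pos_iff_ne_zero.mpr hx
  filter_upwards [Real.tendsto_exp_neg_atTop_nhds_zero.eventually (gt_mem_nhds hx')] with r hr
  rw [indicator_of_mem]
  exact (show Real.exp (-r) < x from hr).le

/-- The spectral family of a functional calculus on the unit interval without mass at `0`, under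
the change of variables `x = exp (-s)`. -/
def spectralFamilyOfCalculus {μ : H → Measure I} {Φ : (I → ℝ) → H →L[ℝ] H}
    (C : IsBorelCalculus μ Φ) (h0 : ∀ f, μ f {0} = 0)
    (hone : Φ (fun _ => 1) = ContinuousLinearMap.id ℝ H) : SpectralFamily H where
  proj s := Φ ((expTail s).indicator fun _ => 1)
  isStarProjection s := by
    have hb := isBddMeas_indicator_one (measurableSet_expTail s)
    refine ⟨?_, ContinuousLinearMap.isSelfAdjoint_iff_isSymmetric.mpr (C.symm _ hb)⟩
    change Φ _ ∘L Φ _ = _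
    rw [← C.mul _ _ hb hb]
    congr 1
    ext x
    by_cases h : x ∈ expTail s <;> simp [h]
  proj_of_neg s hs := by
    have : (expTail s).indicator (fun _ => (1 : ℝ)) = fun x => 0 * (1 : ℝ) := by
      ext x
      rw [indicator_of_notMem, zero_mul]
      refine not_le.mpr (x.2.2.trans_lt ?_)
      rw [Real.one_lt_exp_iff]
      linarith
    rw [this, C.map_const_mul 0 (IsBddMeas.const 1), zero_smul]
  proj_comp r s hrs := by
    rw [← C.mul _ _ (isBddMeas_indicator_one (measurableSet_expTail r))
      (isBddMeas_indicator_one (measurableSet_expTail s))]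
    congr 1
    ext x
    by_cases h : x ∈ expTail r
    · simp [h, expTail_mono hrs h]
    · simp [h]
  right_continuous f s :=
    C.tendsto (B := 1)
      (Eventually.of_forall fun r => isBddMeas_indicator_one (measurableSet_expTail r))
      (isBddMeas_indicator_one (measurableSet_expTail s))
      (Eventually.of_forall fun r => ae_of_all _ fun x => by
        by_cases h : x ∈ expTail r <;> simp [h])
      (ae_of_all _ fun x => tendsto_indicator_expTail s x)
  tendsto_atTop f := by
    have hne : ∀ᵐ x ∂(μ f), x ≠ 0 := by
      rw [ae_iff]
      simpa using h0 f
    have := C.tendsto (f := f) (l := atTop)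
      (Ψ := fun s => (expTail s).indicator fun _ => 1) (B := 1)
      (Eventually.of_forall fun r => isBddMeas_indicator_one (measurableSet_expTail r))
      (IsBddMeas.const 1)
      (Eventually.of_forall fun r => ae_of_all _ fun x => by
        by_cases h : x ∈ expTail r <;> simp [h])
      (hne.mono fun x hx => tendsto_indicator_expTail_atTop hx)
    rwa [hone] at this

theorem spectralFamilyOfCalculus_measure {μ : H → Measure I} {Φ : (I → ℝ) → H →L[ℝ] H}
    (C : IsBorelCalculus μ Φ) (h0 : ∀ f, μ f {0} = 0)
    (hone : Φ (fun _ => 1) = ContinuousLinearMap.id ℝ H) (f : H) :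
    (spectralFamilyOfCalculus C h0 hone).measure f =
      (μ f).map fun x : I => -Real.log x := by
  have := C.finite f
  have hm : Measurable fun x : I => -Real.log x := by fun_prop
  refine Measure.ext_of_Iic _ _ fun s => ?_
  rw [← measureReal_eq_measureReal_iff, SpectralFamily.measure_real_Iic,
    map_measureReal_apply hm measurableSet_Iic]
  change inner ℝ (Φ ((expTail s).indicator fun _ => 1) f) f = _
  rw [C.quad _ (isBddMeas_indicator_one (measurableSet_expTail s)),
    integral_indicator_const _ (measurableSet_expTail s), smul_eq_mul, mul_one]
  refine measureReal_congr ?_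
  -- Since `Real.log 0 = 0`, the point `x = 0` would be sent to `s = 0` instead of `∞`; this is
  -- harmless because it has no mass.
  have hne : ∀ᵐ x ∂(μ f), x ≠ 0 := by
    rw [ae_iff]
    simpa using h0 f
  filter_upwards [hne] with x hx
  have hx' : 0 < (x : ℝ) := unitInterval.pos_iff_ne_zero.mpr hx
  refine propext ?_
  change Real.exp (-s) ≤ x ↔ -Real.log x ≤ s
  rw [← Real.le_log_iff_exp_le hx', neg_le]

theorem exists_spectralFamily {P : NNReal → H →L[ℝ] H} (hP : IsContractionSemigroup P)
    (hsymm : ∀ t f g, inner ℝ (P t f) g = inner ℝ f (P t g)) :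
    ∃ E : SpectralFamily H, IsSpectralFamilyOfNegGenerator P E := by
  choose μ hfin h0 hμ using exists_representation hP hsymm
  have hmass : ∀ f, (μ f).real univ = ‖f‖ ^ 2 := fun f => by
    have := hμ f 0
    simpa [hP.zero] using this
  have D : SpectralData μ (fun (t : NNReal) (x : I) => (x : ℝ) ^ (t : ℝ)) P :=
    { finite := hfin
      mass := fun f => (hmass f).le
      bddMeas := fun t => isBddMeas_rpow t.2
      determines := determines_rpow
      symm := hsymm
      quad := fun t f => hμ f t
      mul := fun s t => ⟨s + t,
        funext fun x => Real.rpow_add_of_nonneg x.2.1 s.2 t.2, hP.add s t⟩ }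
  obtain ⟨Φ, C, hΦ⟩ := D.exists_isBorelCalculus
  have hone : Φ (fun _ => 1) = ContinuousLinearMap.id ℝ H := by
    rw [← hP.zero, ← hΦ 0]
    simp
  let E := spectralFamilyOfCalculus C h0 hone
  -- It is enough to compare quadratic forms, where `s = -log x` turns `exp (-ts)` into `x ^ t`.
  have hE : E.semigroup = P := by
    ext1 t
    refine ext_of_quadratic (E.op_symm (bddOn_exp t)) (hsymm t) fun f => ?_
    rw [SpectralFamily.semigroup, E.op_quad (bddOn_exp t), spectralFamilyOfCalculus_measure,
      integral_map (by fun_prop) (by fun_prop), ← hμ f t]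
    have hne : ∀ᵐ x ∂(μ f), x ≠ 0 := by
      rw [ae_iff]
      simpa using h0 f
    refine integral_congr_ae ?_
    filter_upwards [hne] with x hx
    have hx' : 0 < (x : ℝ) := unitInterval.pos_iff_ne_zero.mpr hx
    rw [Real.rpow_def_of_pos hx']
    congr 1
    ring
  refine ⟨E, fun f a => ?_⟩
  rw [← hE]
  exact E.isGeneratorValue_semigroup_iff f a

end

/-! ### Contractivity of symmetric sub-Markovian semigroups. -/

section

variable {H : Type*} [NormedAddCommGroup H] [InnerProductSpace ℝ H] {P : NNReal → H →L[ℝ] H}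

/-- Symmetry gives `‖P s f‖² ≤ ‖P (2s) f‖ ‖f‖`. If `‖P t f‖ / ‖f‖` exceeded `1`, repeated doubling
would force at least its power `2 ^ n` at time `2 ^ n t`, contradicting boundedness. -/
theorem norm_le_of_bounded_orbit (hadd : ∀ s t, P (s + t) = P s ∘L P t)
    (hsymm : ∀ t f g, inner ℝ (P t f) g = inner ℝ f (P t g)) {f : H} {C : ℝ}
    (hC : ∀ t, ‖P t f‖ ≤ C) (t : NNReal) : ‖P t f‖ ≤ ‖f‖ := by
  rcases eq_or_ne f 0 with rfl | hf
  · simp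
  have hf' : 0 < ‖f‖ := norm_pos_iff.mpr hf
  have hsq : ∀ s, ‖P s f‖ ^ 2 ≤ ‖P (2 * s) f‖ * ‖f‖ := fun s => by
    have : ‖P s f‖ ^ 2 = inner ℝ (P (2 * s) f) f := by
      rw [two_mul, hadd, ContinuousLinearMap.comp_apply, hsymm, real_inner_self_eq_norm_sq]
    rw [this]
    exact real_inner_le_norm _ _
  by_contra! hlt
  have ha : 1 < ‖P t f‖ / ‖f‖ := (one_lt_div hf').mpr hlt
  have hpow : ∀ n : ℕ, (‖P t f‖ / ‖f‖) ^ 2 ^ n ≤ ‖P (2 ^ n * t) f‖ / ‖f‖ := by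
    intro n
    induction n with
    | zero => simp
    | succ n ih =>
      rw [pow_succ 2 n, pow_mul, pow_succ' 2 n, mul_assoc]
      refine (pow_le_pow_left₀ (by positivity) ih 2).trans ?_
      rw [div_pow, div_le_div_iff₀ (by positivity) hf']
      nlinarith [mul_le_mul_of_nonneg_right (hsq (2 ^ n * t)) hf'.le]
  obtain ⟨n, hn⟩ := pow_unbounded_of_one_lt (C / ‖f‖) ha
  have h1 : (‖P t f‖ / ‖f‖) ^ n ≤ (‖P t f‖ / ‖f‖) ^ 2 ^ n :=
    pow_le_pow_right₀ ha.le Nat.lt_two_pow_self.le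
  have h2 : ‖P (2 ^ n * t) f‖ / ‖f‖ ≤ C / ‖f‖ := by
    gcongr
    exact hC _
  linarith [hpow n]

/-- The vectors with a bounded orbit. -/
def boundedOrbits (P : NNReal → H →L[ℝ] H) : Submodule ℝ H where
  carrier := {f | ∃ C, ∀ t, ‖P t f‖ ≤ C}
  add_mem' := by
    rintro f g ⟨C, hC⟩ ⟨D, hD⟩
    refine ⟨C + D, fun t => ?_⟩
    rw [map_add]
    exact (norm_add_le _ _).trans (add_le_add (hC t) (hD t))
  zero_mem' := ⟨0, by simp⟩
  smul_mem' := by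
    rintro c f ⟨C, hC⟩
    refine ⟨‖c‖ * C, fun t => ?_⟩
    rw [map_smul, norm_smul]
    exact mul_le_mul_of_nonneg_left (hC t) (norm_nonneg c)

theorem norm_le_of_dense_boundedOrbits (hadd : ∀ s t, P (s + t) = P s ∘L P t)
    (hsymm : ∀ t f g, inner ℝ (P t f) g = inner ℝ f (P t g))
    (hdense : ∀ f, f ∈ (boundedOrbits P).topologicalClosure) (t : NNReal) (f : H) :
    ‖P t f‖ ≤ ‖f‖ := by
  have hclosed : IsClosed {f | ‖P t f‖ ≤ ‖f‖} := isClosed_le (by fun_prop) (by fun_prop)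
  refine closure_minimal (s := (boundedOrbits P : Set H)) ?_ hclosed (hdense f)
  rintro g ⟨C, hC⟩
  exact norm_le_of_bounded_orbit hadd hsymm hC t

end

section

variable {X : Type*} [MeasurableSpace X] {m : Measure X} {P : NNReal → Lp ℝ 2 m →L[ℝ] Lp ℝ 2 m}

/-- By symmetry `‖P t 1_A‖² = (P (2t) 1_A, 1_A)`, and the sub-Markov property puts `P (2t) 1_A`
between `0` and `1`. -/
theorem IsSymmetricSubMarkovSemigroup.norm_sq_indicator_le (hP : IsSymmetricSubMarkovSemigroup m P)
    {A : Set X} (hA : MeasurableSet A) (hm : m A ≠ ⊤) (t : NNReal) :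
    ‖P t (indicatorConstLp 2 hA hm (1 : ℝ))‖ ^ 2 ≤ m.real A := by
  set f := indicatorConstLp 2 hA hm (1 : ℝ)
  have h1 : ‖P t f‖ ^ 2 = ∫ x in A, P (t + t) f x ∂m := by
    rw [← L2.inner_indicatorConstLp_one hA hm, hP.add, ContinuousLinearMap.comp_apply,
      ← hP.symmetric, real_inner_self_eq_norm_sq]
  have hf : ∀ᵐ x ∂m, 0 ≤ f x ∧ f x ≤ 1 := by
    filter_upwards [indicatorConstLp_coeFn (p := 2) (hs := hA) (hμs := hm) (c := (1 : ℝ))]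
      with x hx
    rw [show f x = A.indicator (fun _ => (1 : ℝ)) x from hx]
    by_cases h : x ∈ A <;> simp [h]
  rw [h1]
  have h2 : ‖∫ x in A, P (t + t) f x ∂m‖ ≤ 1 * m.real A := by
    refine norm_setIntegral_le_of_norm_le_const_ae' (lt_top_iff_ne_top.mpr hm) ?_
    filter_upwards [hP.subMarkovian (t + t) f hf] with x hx _
    rw [Real.norm_eq_abs, abs_of_nonneg hx.1]
    exact hx.2
  rw [one_mul] at h2
  exact (le_abs_self _).trans h2

/-- Indicators of sets of finite measure have bounded orbits and span a dense subspace. There the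
doubling argument gives contractivity, and continuity of each `P t` extends it to all of `L²(m)`. -/
theorem IsSymmetricSubMarkovSemigroup.isContractionSemigroup
    (hP : IsSymmetricSubMarkovSemigroup m P) : IsContractionSemigroup P where
  zero := hP.zero
  add := hP.add
  strongly_continuous := hP.strongly_continuous
  norm_le := by
    refine norm_le_of_dense_boundedOrbits hP.add hP.symmetric fun f => ?_
    refine Lp.induction (by norm_num) (fun f => f ∈ (boundedOrbits P).topologicalClosure)
      (fun c A hA hm => ?_) (fun f g hf hg _ h1 h2 => Submodule.add_mem _ h1 h2)
      (Submodule.isClosed_topologicalClosure _) f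
    refine Submodule.le_topologicalClosure _ ?_
    have h1 : indicatorConstLp 2 hA hm.ne c = c • indicatorConstLp 2 hA hm.ne (1 : ℝ) := by
      refine Lp.ext ?_
      filter_upwards [indicatorConstLp_coeFn (p := 2) (hs := hA) (hμs := hm.ne) (c := c),
        Lp.coeFn_smul c (indicatorConstLp 2 hA hm.ne (1 : ℝ)),
        indicatorConstLp_coeFn (p := 2) (hs := hA) (hμs := hm.ne) (c := (1 : ℝ))] with x h1 h2 h3
      rw [h1, h2, Pi.smul_apply, h3]
      by_cases hx : x ∈ A <;> simp [hx]
    rw [Lp.simpleFunc.coe_indicatorConst, h1]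
    refine Submodule.smul_mem _ _ ⟨Real.sqrt (m.real A), fun t => ?_⟩
    exact Real.le_sqrt_of_sq_le (hP.norm_sq_indicator_le hA hm.ne t)

end

end MarkovInverse

end

theorem theorem3p1 {X : Type*} [MeasurableSpace X] (m : MeasureTheory.Measure X)
    [MeasureTheory.SigmaFinite m]
    (P : NNReal → MeasureTheory.Lp ℝ 2 m →L[ℝ] MeasureTheory.Lp ℝ 2 m)
    (hP : MarkovInverse.IsSymmetricSubMarkovSemigroup m P) :
    (∃ E : MarkovInverse.SpectralFamily (MeasureTheory.Lp ℝ 2 m),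
      MarkovInverse.IsSpectralFamilyOfNegGenerator P E) ∧
    ∀ E : MarkovInverse.SpectralFamily (MeasureTheory.Lp ℝ 2 m),
      MarkovInverse.IsSpectralFamilyOfNegGenerator P E →
    ∀ (t : NNReal), 0 < t →
    ∀ φ : ℝ → ℝ, ContinuousOn φ (Set.Ici 0) → (∀ x, 0 ≤ x → 0 ≤ φ x) →
      0 < Filter.liminf (fun x : ℝ => (φ x : EReal)) Filter.atTop →
      BddAbove ((fun x : ℝ => Real.exp (-(t * x)) * φ x) '' Set.Ici 0) →
    ∃ B : MeasureTheory.Lp ℝ 2 m →L[ℝ] MeasureTheory.Lp ℝ 2 m,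
      MarkovInverse.IsSemigroupComp P E φ t B ∧
      ∀ γ : ℝ, 0 < γ → γ < 1 → ∀ g : MeasureTheory.Lp ℝ 2 m,
        ∃ f : MeasureTheory.Lp ℝ 2 m,
          MarkovInverse.IsRegularisedSolution P E φ t γ g f ∧
          (∀ f', MarkovInverse.IsRegularisedSolution P E φ t γ g f' → f' = f) ∧
          E.IsIntegral (fun s => 1 / (γ * φ s + (1 - γ) * Real.exp (-(s * t)))) g f ∧
          ∀ h, h ≠ (1 - γ) • f →
            MarkovInverse.functional P B t γ g ((1 - γ) • f) <
              MarkovInverse.functional P B t γ g h := by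
  have hc := hP.isContractionSemigroup
  refine ⟨MarkovInverse.exists_spectralFamily hc hP.symmetric, ?_⟩
  intro E hE t ht φ hφ h0 hlim hbdd
  have hPt := E.eq_semigroup hc hE t
  have hb := MarkovInverse.bddOn_exp_mul hφ h0 hbdd
  exact ⟨_, E.isSemigroupComp_op hPt hφ hb, fun γ hγ hγ' g =>
    E.exists_unique_regularisedSolution hPt ht hφ h0 hlim hb hγ hγ' g⟩
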